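/- Let $\mathrm{Haar}(D)$ be the uniform probability measure on the unit sphere of $\mathbb{C}^D$. For a measure $\mathcal{E}$ on $\mathbb{C}^D$ (an ensemble of vectors) write $\rho^{(k)}_{\mathcal{E}}=\mathbb{E}_{\psi\sim\mathcal{E}}(|\psi\rangle\langle\psi|)^{\otimes k}$ for its $k$-th moment; in particular $\rho^{(k)}_{\mathrm{Haar}}$ is the $k$-th moment of $\mathrm{Haar}(D)$. For a density matrix $\sigma$ on $\mathbb{C}^D$ (positive semidefinite, $\operatorname{Tr}\sigma=1$), let $\mathrm{Scrooge}(\sigma)$ be the ensemble of the states $\sqrt{\sigma}|\phi\rangle/\|\sqrt{\sigma}|\phi\rangle\|$ weighted by $D\langle\phi|\sigma|\phi\rangle\,d\phi$, where $d\phi$ is $\mathrm{Haar}(D)$, with $k$-th moment $\rho^{(k)}_{\mathrm{Scrooge}}(\sigma)$, and let $\tilde{\mathcal{E}}$ be the ensemble of unnormalized vectors $\sqrt{D\sigma}|\phi\rangle$ with $|\phi\rangle\sim\mathrm{Haar}(D)$, with $k$-th moment $\tilde\rho^{(k)}_{\mathrm{Scrooge}}(\sigma)$. Let $\|A\|_p=(\operatorname{Tr}|A|^p)^{1/p}$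 be the Schatten norms and $\preceq$ the Loewner order. An ensemble $\mathcal{E}$ is called a $\mathrm{Scrooge}(\sigma)$ $k$-design with additive error $\epsilon$ if $\tfrac12\|\rho^{(k)}_{\mathcal{E}}-\rho^{(k)}_{\mathrm{Scrooge}}(\sigma)\|_1\le\epsilon$, and with relative error $\epsilon$ if $(1-\epsilon)\rho^{(k)}_{\mathrm{Scrooge}}(\sigma)\preceq\rho^{(k)}_{\mathcal{E}}\preceq(1+\epsilon)\rho^{(k)}_{\mathrm{Scrooge}}(\sigma)$. **Lemma.** For all $D$, all $k$ and every density matrix $\sigma$ on $\mathbb{C}^D$, $$\tilde\rho^{(k)}_{\mathrm{Scrooge}}(\sigma)=(D\sigma)^{\otimes k}\rho^{(k)}_{\mathrm{Haar}}.$$ Moreover there are absolute constants $c,C>0$ such that for all $D$, all $k\ge 1$ and every density matrix $\sigma$ on $\mathbb{C}^D$ with $k^2\|\sigma\|_2\le c$: 1. $\tilde{\mathcal{E}}$ is a $\mathrm{Scrooge}(\sigma)$ $k$-design with additive error $C\,k\|\sigma\|_2$, and moreover $\|\rho^{(k)}_{\mathrm{Scrooge}}(\sigma)-\tilde\rho^{(k)}_{\mathrm{Scrooge}}(\sigma)\|_1\le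 C\,k\|\sigma\|_2$; 2. with $\epsilon=C\,4^k k\|\sigma\|_2$, $\tilde{\mathcal{E}}$ is a $\mathrm{Scrooge}(\sigma)$ $k$-design with relative error $\epsilon$, and also $(1-\epsilon)\tilde\rho^{(k)}_{\mathrm{Scrooge}}(\sigma)\preceq\rho^{(k)}_{\mathrm{Scrooge}}(\sigma)\preceq(1+\epsilon)\tilde\rho^{(k)}_{\mathrm{Scrooge}}(\sigma)$. -/

import Mathlib

open MeasureTheory
open scoped MatrixOrder ComplexOrder

noncomputable section

namespace Scrooge

/-- The Schatten norm `‖A‖_p = (Tr |A| ^ p) ^ (1 / p)`, where `|A| = √(A† A)`, for an integer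
`p ≥ 1`. -/
def schattenNorm {n : Type*} [Fintype n] [DecidableEq n] (p : ℕ) (A : Matrix n n ℂ) : ℝ :=
  ((CFC.abs A) ^ p).trace.re ^ (1 / (p : ℝ))

/-- Density matrices: positive semidefinite matrices of unit trace. -/
def IsDensityMatrix {D : ℕ} (σ : Matrix (Fin D) (Fin D) ℂ) : Prop :=
  σ.PosSemidef ∧ σ.trace = 1

/-- The operator `|ψ⟩⟨ψ|` of a (not necessarily normalized) vector `ψ` of `ℂ ^ D`. -/
def ketbra {D : ℕ} (ψ : EuclideanSpace ℂ (Fin D)) : Matrix (Fin D) (Fin D) ℂ :=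
  Matrix.of fun i j => ψ i * star (ψ j)

/-- The `k`-fold tensor power `A^{⊗k}` as an operator on `(ℂ ^ D)^{⊗k}`, written in the product
basis, which is indexed by the maps `Fin k → Fin D`. -/
def tensorPow {D : ℕ} (k : ℕ) (A : Matrix (Fin D) (Fin D) ℂ) :
    Matrix (Fin k → Fin D) (Fin k → Fin D) ℂ :=
  Matrix.of fun i j => ∏ a, A (i a) (j a)

/-- The action of a matrix on a vector of `ℂ ^ D`. -/
def act {D : ℕ} (A : Matrix (Fin D) (Fin D) ℂ) (φ : EuclideanSpace ℂ (Fin D)) :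
    EuclideanSpace ℂ (Fin D) :=
  WithLp.toLp 2 (A.mulVec φ.ofLp)

/-- The expectation value `⟨φ|σ|φ⟩` (its real part, which is all of it for Hermitian `σ`). -/
def expVal {D : ℕ} (σ : Matrix (Fin D) (Fin D) ℂ) (φ : EuclideanSpace ℂ (Fin D)) : ℝ :=
  (inner ℂ φ (act σ φ)).re

/-- `Haar(D)`: the uniform probability measure on the unit sphere of `ℂ ^ D` (the surface measure,
divided by its total mass), regarded as a measure on `ℂ ^ D`. -/
def haar (D : ℕ) : Measure (EuclideanSpace ℂ (Fin D)) :=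
  Measure.map Subtype.val
    (((volume : Measure (EuclideanSpace ℂ (Fin D))).toSphere Set.univ)⁻¹ •
      (volume : Measure (EuclideanSpace ℂ (Fin D))).toSphere)

/-- The `k`-th moment `E_{ψ ∼ ℰ} (|ψ⟩⟨ψ|)^{⊗k}` of an ensemble `ℰ` of vectors of `ℂ ^ D`. -/
def moment {D : ℕ} (k : ℕ) (ℰ : Measure (EuclideanSpace ℂ (Fin D))) :
    Matrix (Fin k → Fin D) (Fin k → Fin D) ℂ :=
  Matrix.of fun i j => ∫ ψ, tensorPow k (ketbra ψ) i j ∂ℰ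

/-- The Scrooge ensemble of `σ`: the vector `√σ|φ⟩ / ‖√σ|φ⟩‖` with weight `D ⟨φ|σ|φ⟩ dφ`. -/
def scrooge {D : ℕ} (σ : Matrix (Fin D) (Fin D) ℂ) : Measure (EuclideanSpace ℂ (Fin D)) :=
  ((haar D).withDensity fun φ => ENNReal.ofReal (D * expVal σ φ)).map fun φ =>
    (‖act (CFC.sqrt σ) φ‖⁻¹ : ℂ) • act (CFC.sqrt σ) φ

/-- The unnormalized Scrooge ensemble of `σ`: the vectors `√(Dσ)|φ⟩`, with `φ` Haar-distributed. -/
def unnormScrooge {D : ℕ} (σ : Matrix (Fin D) (Fin D) ℂ) : Measure (EuclideanSpace ℂ (Fin D)) :=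
  (haar D).map (act (CFC.sqrt ((D : ℂ) • σ)))

/-- `ℰ` is a Scrooge(`σ`) `k`-design with additive error `ε`. -/
def IsAdditiveScroogeDesign {D : ℕ} (σ : Matrix (Fin D) (Fin D) ℂ) (k : ℕ)
    (ℰ : Measure (EuclideanSpace ℂ (Fin D))) (ε : ℝ) : Prop :=
  1 / 2 * schattenNorm 1 (moment k ℰ - moment k (scrooge σ)) ≤ ε

/-- `ℰ` is a Scrooge(`σ`) `k`-design with relative error `ε`; `≤` is the Loewner order. -/
def IsRelativeScroogeDesign {D : ℕ} (σ : Matrix (Fin D) (Fin D) ℂ) (k : ℕ)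
    (ℰ : Measure (EuclideanSpace ℂ (Fin D))) (ε : ℝ) : Prop :=
  (1 - ε) • moment k (scrooge σ) ≤ moment k ℰ ∧ moment k ℰ ≤ (1 + ε) • moment k (scrooge σ)

end Scrooge

end

/-! Write `X = D ⟨φ|σ|φ⟩ = ‖√(Dσ) φ‖ ^ 2` and `ψ = √(Dσ) φ`, with `φ` Haar-distributed. The moments
of the two ensembles are `E X ^ (1 - k) (|ψ⟩⟨ψ|)^{⊗k}` for the Scrooge ensemble (`moment_scrooge`)
and `E (|ψ⟩⟨ψ|)^{⊗k}` for the unnormalized one (`moment_unnormScrooge`), so everything depends on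
how well `X` is concentrated around its mean `1`.

The product formula `(D σ)^{⊗k} ρ_Haar` says that the Haar moment commutes with `√(Dσ)^{⊗k}`
(`commute_tensorPow_moment_haar`). By unitary invariance one may take `√(Dσ)` diagonal, and then
invariance under phases makes monomials of different multidegree orthogonal on the sphere.

For the trace norm, `(|ψ⟩⟨ψ|)^{⊗k}` has trace `X ^ k`, so the distance of the two moments is at
most `E |X - X ^ k|` (`schattenNorm_scrooge_sub_le`). Now `X - X ^ k` is `1 - X` times a sum of
powers of `X`; the variance of `X` is at most `‖σ‖_2 ^ 2`, and its moments of order `O(k)` are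
bounded as long as `k ^ 2 ‖σ‖_2` is small (`integral_haar_abs_sub_pow_le`).

For the relative error, the quadratic form of either moment is the integral of `|P| ^ 2`, with a
weight `X ^ (1 - k)` or `1`, for a homogeneous polynomial `P` of degree `k`. In an eigenbasis of
`σ` the weight depends on the moduli of the coordinates only, so by orthogonality it suffices to
compare the weighted integrals of the monomials `|φ ^ α| ^ 2`
(`integral_haar_normSq_tensorPoly_nonneg`). This is done in `integral_haar_weighted_bounds`, with a
relative error `6 k ^ 2 ‖σ‖_2`, which is stronger than the claimed `O(4 ^ k k ‖σ‖_2)`. The lower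
bound is Bernoulli's inequality together with a bound on the weighted mean of `X`. For the upper
bound the sphere is replaced by the Gaussian measure, for which functions homogeneous of a given
degree have the same integral up to a factor (`gaussInt_eq_mul_integral_haar`), and `X / D` by `Y =
∑ λ_i |z_i| ^ 2`. Stein's identity (`gaussInt_stein`) bounds the weighted moment of `Y ^ (-j)` by
that of `Y ^ (1 - j)`, up to the factor `(1 - j ‖σ‖_2)⁻¹`: the derivative of the monomial
contributes with the good sign. The same identity bounds the positive moments of `Y`. -/

noncomputable section

namespace Scrooge

/-! ### Gaussian integration by parts -/

section

variable {D : ℕ}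

/-- Continuous functions on `ℂ ^ D` of at most polynomial growth: the class of functions whose
product with the Gaussian weight `exp (-‖z‖ ^ 2)` is integrated below. -/
def PolyGrowth (F : EuclideanSpace ℂ (Fin D) → ℝ) : Prop :=
  Continuous F ∧ ∃ (C : ℝ) (N : ℕ), 0 ≤ C ∧ ∀ z, |F z| ≤ C * (1 + ‖z‖) ^ N

namespace PolyGrowth

variable {F G : EuclideanSpace ℂ (Fin D) → ℝ}

lemma of_bounded (hF : Continuous F) (C : ℝ) (h : ∀ z, |F z| ≤ C) : PolyGrowth F :=
  ⟨hF, C, 0, (abs_nonneg _).trans (h 0), by simpa using h⟩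

lemma const (c : ℝ) : PolyGrowth (fun _ : EuclideanSpace ℂ (Fin D) => c) :=
  of_bounded continuous_const |c| fun _ => le_rfl

lemma mul (hF : PolyGrowth F) (hG : PolyGrowth G) : PolyGrowth (fun z => F z * G z) := by
  obtain ⟨hF, C, N, hC, h⟩ := hF
  obtain ⟨hG, C', N', hC', h'⟩ := hG
  refine ⟨hF.mul hG, C * C', N + N', by positivity, fun z => ?_⟩
  rw [abs_mul, pow_add]
  calc |F z| * |G z| ≤ (C * (1 + ‖z‖) ^ N) * (C' * (1 + ‖z‖) ^ N') := by gcongr <;> simp [h, h']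
    _ = _ := by ring

lemma add (hF : PolyGrowth F) (hG : PolyGrowth G) : PolyGrowth (fun z => F z + G z) := by
  obtain ⟨hF, C, N, hC, h⟩ := hF
  obtain ⟨hG, C', N', hC', h'⟩ := hG
  refine ⟨hF.add hG, C + C', max N N', by positivity, fun z => ?_⟩
  have h1 : (1 : ℝ) ≤ 1 + ‖z‖ := by simp
  calc |F z + G z| ≤ |F z| + |G z| := abs_add_le _ _
    _ ≤ C * (1 + ‖z‖) ^ N + C' * (1 + ‖z‖) ^ N' := add_le_add (h z) (h' z)
    _ ≤ C * (1 + ‖z‖) ^ (max N N') + C' * (1 + ‖z‖) ^ (max N N') := by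
        gcongr <;> simp
    _ = _ := by ring

lemma sub (hF : PolyGrowth F) (hG : PolyGrowth G) : PolyGrowth (fun z => F z - G z) := by
  simpa [sub_eq_add_neg] using hF.add ((const (-1)).mul hG)

lemma pow (hF : PolyGrowth F) (n : ℕ) : PolyGrowth (fun z => F z ^ n) := by
  induction n with
  | zero => simpa using const 1
  | succ n ih => simpa [pow_succ] using ih.mul hF

lemma sum {ι : Type*} (s : Finset ι) {F : ι → EuclideanSpace ℂ (Fin D) → ℝ}
    (h : ∀ i, PolyGrowth (F i)) : PolyGrowth (fun z => ∑ i ∈ s, F i z) := by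
  classical
  induction s using Finset.induction_on with
  | empty => simpa using const 0
  | insert a s ha ih => simpa [Finset.sum_insert ha] using (h a).add ih

lemma prod {ι : Type*} (s : Finset ι) {F : ι → EuclideanSpace ℂ (Fin D) → ℝ}
    (h : ∀ i, PolyGrowth (F i)) : PolyGrowth (fun z => ∏ i ∈ s, F i z) := by
  classical
  induction s using Finset.induction_on with
  | empty => simpa using const 1
  | insert a s ha ih => simpa [Finset.prod_insert ha] using (h a).mul ih

lemma of_abs_le_norm (hF : Continuous F) (h : ∀ z, |F z| ≤ ‖z‖) : PolyGrowth F :=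
  ⟨hF, 1, 1, zero_le_one, fun z => by linarith [h z]⟩

lemma norm_apply (i : Fin D) : PolyGrowth (fun z : EuclideanSpace ℂ (Fin D) => ‖z i‖) :=
  of_abs_le_norm (by fun_prop) fun z => by simpa using PiLp.norm_apply_le z i

lemma re_apply (i : Fin D) : PolyGrowth (fun z : EuclideanSpace ℂ (Fin D) => (z i).re) :=
  of_abs_le_norm (by fun_prop) fun z => (Complex.abs_re_le_norm _).trans (PiLp.norm_apply_le z i)

lemma im_apply (i : Fin D) : PolyGrowth (fun z : EuclideanSpace ℂ (Fin D) => (z i).im) :=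
  of_abs_le_norm (by fun_prop) fun z => (Complex.abs_im_le_norm _).trans (PiLp.norm_apply_le z i)

lemma integrable (hF : PolyGrowth F) :
    Integrable (fun z => F z * Real.exp (-‖z‖ ^ 2)) := by
  obtain ⟨hF, C, N, hC, h⟩ := hF
  have hgauss : Integrable
      (fun z : EuclideanSpace ℂ (Fin D) => Real.exp (-(1 / 2 : ℝ) * ‖z‖ ^ 2)) := by
    have := (GaussianFourier.integrable_cexp_neg_mul_sq_norm_add
      (V := EuclideanSpace ℂ (Fin D)) (b := (1 / 2 : ℂ)) (by norm_num) 0 0).norm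
    refine this.congr (ae_of_all _ fun z => ?_)
    simp only [Complex.norm_exp]
    congr 1
    rw [show (-(1 / 2 : ℂ) * (‖z‖ : ℂ) ^ 2 +
        0 * ((inner ℝ (0 : EuclideanSpace ℂ (Fin D)) z : ℝ) : ℂ))
      = ((-(1 / 2 : ℝ) * ‖z‖ ^ 2 : ℝ) : ℂ) by push_cast; ring]
    exact Complex.ofReal_re _
  refine (hgauss.const_mul (C * (N.factorial * Real.exp (3 / 2)))).mono'
    (by fun_prop) (ae_of_all _ fun z => ?_)
  rw [Real.norm_eq_abs, abs_mul, Real.abs_exp]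
  have h1 : (1 + ‖z‖) ^ N ≤ N.factorial * Real.exp (1 + ‖z‖) := by
    have := Real.pow_div_factorial_le_exp (1 + ‖z‖) (by positivity) N
    rw [div_le_iff₀ (by positivity)] at this
    linarith
  calc |F z| * Real.exp (-‖z‖ ^ 2)
      ≤ C * (N.factorial * Real.exp (1 + ‖z‖)) * Real.exp (-‖z‖ ^ 2) := by
        gcongr
        exact (h z).trans (by gcongr)
    _ = C * (N.factorial * Real.exp (1 + ‖z‖ - ‖z‖ ^ 2)) := by
        rw [mul_assoc, mul_assoc, ← Real.exp_add]; ring_nf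
    _ ≤ C * (N.factorial * Real.exp (3 / 2 + -(1 / 2 : ℝ) * ‖z‖ ^ 2)) := by
        gcongr
        nlinarith [sq_nonneg (‖z‖ - 1)]
    _ = _ := by rw [Real.exp_add]; ring

end PolyGrowth

/-- The diagonal quadratic form `∑ λ_l |z_l| ^ 2`. -/
def quad (lam : Fin D → ℝ) (z : EuclideanSpace ℂ (Fin D)) : ℝ := ∑ l, lam l * ‖z l‖ ^ 2

/-- The squared modulus `|z ^ α| ^ 2` of the monomial with exponent vector `α`. -/
def monoSq (α : Fin D → ℕ) (z : EuclideanSpace ℂ (Fin D)) : ℝ := ∏ l, (‖z l‖ ^ 2) ^ α l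

lemma PolyGrowth.quad (lam : Fin D → ℝ) : PolyGrowth (quad lam) :=
  PolyGrowth.sum _ fun l => (PolyGrowth.const _).mul ((PolyGrowth.norm_apply l).pow 2)

lemma PolyGrowth.monoSq (α : Fin D → ℕ) : PolyGrowth (monoSq α) :=
  PolyGrowth.prod _ fun l => ((PolyGrowth.norm_apply l).pow 2).pow _

lemma quad_nonneg {lam : Fin D → ℝ} (h : ∀ l, 0 ≤ lam l) (z : EuclideanSpace ℂ (Fin D)) :
    0 ≤ quad lam z :=
  Finset.sum_nonneg fun l _ => mul_nonneg (h l) (by positivity)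

lemma monoSq_nonneg (α : Fin D → ℕ) (z : EuclideanSpace ℂ (Fin D)) : 0 ≤ monoSq α z :=
  Finset.prod_nonneg fun l _ => by positivity

/-- The (unnormalized) Gaussian integral of a function on `ℂ ^ D`. -/
def gaussInt (F : EuclideanSpace ℂ (Fin D) → ℝ) : ℝ := ∫ z, F z * Real.exp (-‖z‖ ^ 2)

lemma gaussInt_add {F G : EuclideanSpace ℂ (Fin D) → ℝ} (hF : PolyGrowth F) (hG : PolyGrowth G) :
    gaussInt (fun z => F z + G z) = gaussInt F + gaussInt G := by
  simp only [gaussInt, add_mul]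
  exact integral_add hF.integrable hG.integrable

lemma gaussInt_const_mul (c : ℝ) (F : EuclideanSpace ℂ (Fin D) → ℝ) :
    gaussInt (fun z => c * F z) = c * gaussInt F := by
  simp only [gaussInt, mul_assoc]
  exact integral_const_mul _ _

lemma gaussInt_sum {ι : Type*} (s : Finset ι) {F : ι → EuclideanSpace ℂ (Fin D) → ℝ}
    (h : ∀ i, PolyGrowth (F i)) :
    gaussInt (fun z => ∑ i ∈ s, F i z) = ∑ i ∈ s, gaussInt (F i) := by
  simp only [gaussInt, Finset.sum_mul]
  exact integral_finsetSum _ fun i _ => (h i).integrable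

lemma gaussInt_mono {F G : EuclideanSpace ℂ (Fin D) → ℝ} (hF : PolyGrowth F) (hG : PolyGrowth G)
    (h : ∀ z, F z ≤ G z) : gaussInt F ≤ gaussInt G :=
  integral_mono hF.integrable hG.integrable fun z =>
    mul_le_mul_of_nonneg_right (h z) (Real.exp_pos _).le

lemma gaussInt_nonneg {F : EuclideanSpace ℂ (Fin D) → ℝ} (h : ∀ z, 0 ≤ F z) : 0 ≤ gaussInt F :=
  integral_nonneg fun z => mul_nonneg (h z) (Real.exp_pos _).le

/-- Along a line in the `i`-th complex coordinate, only `|z_i| ^ 2` varies; `q'` is its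
derivative. -/
lemma hasLineDerivAt_weight {lam : Fin D → ℝ} {g g' : ℝ → ℝ} {α : Fin D → ℕ} (hl : ∀ l, 0 ≤ lam l)
    (hg : ∀ y, 0 ≤ y → HasDerivAt g (g' y) y) (i : Fin D) (z v : EuclideanSpace ℂ (Fin D))
    (q' : ℝ) (hv : ∀ l, l ≠ i → v l = 0)
    (hq : HasDerivAt (fun t : ℝ => ‖z i + t • v i‖ ^ 2) q' 0) :
    HasLineDerivAt ℝ (fun z => g (quad lam z) * monoSq α z * Real.exp (-‖z‖ ^ 2))
      (q' * ((lam i * g' (quad lam z) * monoSq α z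
        + g (quad lam z) * (α i * (‖z i‖ ^ 2) ^ (α i - 1)
            * ∏ l ∈ Finset.univ.erase i, (‖z l‖ ^ 2) ^ α l)
        - g (quad lam z) * monoSq α z) * Real.exp (-‖z‖ ^ 2))) z v := by
  unfold HasLineDerivAt
  have hz : ∀ l, l ≠ i → ∀ t : ℝ, (z + t • v) l = z l := fun l hl t => by simp [hv l hl]
  have hzi : ∀ t : ℝ, (z + t • v) i = z i + t • v i := fun t => by simp
  have h1 : (fun t : ℝ => quad lam (z + t • v)) = fun t : ℝ =>
      lam i * ‖z i + t • v i‖ ^ 2 + ∑ l ∈ Finset.univ.erase i, lam l * ‖z l‖ ^ 2 := by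
    funext t
    rw [quad, ← Finset.add_sum_erase _ _ (Finset.mem_univ i), hzi]
    congr 1
    exact Finset.sum_congr rfl fun l hl => by rw [hz l (Finset.ne_of_mem_erase hl)]
  have h2 : (fun t : ℝ => monoSq α (z + t • v)) = fun t : ℝ =>
      (‖z i + t • v i‖ ^ 2) ^ α i * ∏ l ∈ Finset.univ.erase i, (‖z l‖ ^ 2) ^ α l := by
    funext t
    rw [monoSq, ← Finset.mul_prod_erase _ _ (Finset.mem_univ i), hzi]
    congr 1
    exact Finset.prod_congr rfl fun l hl => by rw [hz l (Finset.ne_of_mem_erase hl)]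
  have h3 : (fun t : ℝ => ‖z + t • v‖ ^ 2) = fun t : ℝ =>
      ‖z i + t • v i‖ ^ 2 + ∑ l ∈ Finset.univ.erase i, ‖z l‖ ^ 2 := by
    funext t
    rw [EuclideanSpace.norm_sq_eq, ← Finset.add_sum_erase _ _ (Finset.mem_univ i), hzi]
    congr 1
    exact Finset.sum_congr rfl fun l hl => by rw [hz l (Finset.ne_of_mem_erase hl)]
  have d1 : HasDerivAt (fun t : ℝ => quad lam (z + t • v)) (lam i * q') 0 := by
    rw [h1]; exact (hq.const_mul _).add_const _
  have d2 : HasDerivAt (fun t : ℝ => monoSq α (z + t • v))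
      (α i * (‖z i‖ ^ 2) ^ (α i - 1) * q' * ∏ l ∈ Finset.univ.erase i, (‖z l‖ ^ 2) ^ α l) 0 := by
    rw [h2]; simpa using (hq.pow (α i)).mul_const _
  have d3 : HasDerivAt (fun t : ℝ => ‖z + t • v‖ ^ 2) q' 0 := by
    rw [h3]; exact hq.add_const _
  have d4 : HasDerivAt (fun t : ℝ => g (quad lam (z + t • v)))
      (g' (quad lam z) * (lam i * q')) 0 := by
    have hy := hg (quad lam (z + (0 : ℝ) • v)) (quad_nonneg hl _)
    refine (hy.comp (0 : ℝ) d1).congr_deriv ?_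
    rw [zero_smul, add_zero]
  refine ((d4.mul d2).mul d3.neg.exp).congr_deriv ?_
  simp only [Pi.mul_apply, Pi.neg_apply, zero_smul, add_zero]
  ring

/-- Gaussian integration by parts (Stein's identity) in the `i`-th complex coordinate, for
functions of the moduli of the coordinates. -/
lemma gaussInt_stein {lam : Fin D → ℝ} {g g' : ℝ → ℝ} (α : Fin D → ℕ) (hl : ∀ l, 0 ≤ lam l)
    (hg : ∀ y, 0 ≤ y → HasDerivAt g (g' y) y)
    (hgp : PolyGrowth fun z : EuclideanSpace ℂ (Fin D) => g (quad lam z))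
    (hgp' : PolyGrowth fun z : EuclideanSpace ℂ (Fin D) => g' (quad lam z)) (i : Fin D) :
    gaussInt (fun z => ‖z i‖ ^ 2 * (g (quad lam z) * monoSq α z)) =
      (α i + 1) * gaussInt (fun z => g (quad lam z) * monoSq α z)
        + lam i * gaussInt (fun z => ‖z i‖ ^ 2 * (g' (quad lam z) * monoSq α z)) := by
  set R : EuclideanSpace ℂ (Fin D) → ℝ := fun z => lam i * g' (quad lam z) * monoSq α z
        + g (quad lam z) * (α i * (‖z i‖ ^ 2) ^ (α i - 1)
            * ∏ l ∈ Finset.univ.erase i, (‖z l‖ ^ 2) ^ α l)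
        - g (quad lam z) * monoSq α z with hR
  have hq : PolyGrowth fun z : EuclideanSpace ℂ (Fin D) => ‖z i‖ ^ 2 :=
    (PolyGrowth.norm_apply i).pow 2
  have hw := PolyGrowth.monoSq α
  have hRp : PolyGrowth R :=
    ((((PolyGrowth.const _).mul hgp').mul hw).add (hgp.mul (((PolyGrowth.const _).mul
      (hq.pow _)).mul (PolyGrowth.prod _ fun l => ((PolyGrowth.norm_apply l).pow 2).pow _)))).sub
      (hgp.mul hw)
  have hG := hgp.mul hw
  have key : ∀ (f : EuclideanSpace ℂ (Fin D) → ℝ) (v : EuclideanSpace ℂ (Fin D)),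
      PolyGrowth f → (∀ l, l ≠ i → v l = 0) →
      (∀ z, HasDerivAt (fun t : ℝ => ‖z i + t • v i‖ ^ 2) (2 * f z) 0) →
      (∀ z, HasLineDerivAt ℝ f 1 z v) →
      gaussInt (fun z => f z * (2 * f z * R z)) =
        - gaussInt (fun z => g (quad lam z) * monoSq α z) := by
    intro f v hf hv hqd hfd
    have := integral_bilinear_hasLineDerivAt_right_eq_neg_left_of_integrable
      (μ := (volume : Measure (EuclideanSpace ℂ (Fin D)))) (B := ContinuousLinearMap.mul ℝ ℝ)
      (f := f) (f' := fun _ => 1) (v := v)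
      (g := fun z => g (quad lam z) * monoSq α z * Real.exp (-‖z‖ ^ 2))
      (g' := fun z => 2 * f z * (R z * Real.exp (-‖z‖ ^ 2)))
      (by simpa using hG.integrable)
      (by simpa [mul_assoc] using (hf.mul (((PolyGrowth.const 2).mul hf).mul hRp)).integrable)
      (by simpa [mul_assoc] using (hf.mul hG).integrable)
      (fun z _ => hfd z)
      (fun z _ => hasLineDerivAt_weight hl hg i z v _ hv (hqd z))
    simpa [gaussInt, mul_assoc] using this
  have hsq : ∀ (w u : ℂ), HasDerivAt (fun t : ℝ => ‖w + t • u‖ ^ 2)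
      (2 * (w.re * u.re + w.im * u.im)) 0 := by
    intro w u
    have h0 : (fun t : ℝ => ‖w + t • u‖ ^ 2) =
        fun t : ℝ => (w.re + t * u.re) ^ 2 + (w.im + t * u.im) ^ 2 := by
      funext t
      rw [← Complex.normSq_eq_norm_sq, Complex.normSq_apply]
      simp; ring
    rw [h0]
    have a : ∀ c d : ℝ, HasDerivAt (fun t : ℝ => (c + t * d) ^ 2) (2 * (c * d)) 0 := by
      intro c d
      have := (((hasDerivAt_id (0 : ℝ)).mul_const d).const_add c).pow 2
      refine this.congr_deriv ?_
      norm_num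
      ring
    exact ((a w.re u.re).add (a w.im u.im)).congr_deriv (by ring)
  have hlin : ∀ (L : ℂ →L[ℝ] ℝ) (v : EuclideanSpace ℂ (Fin D)), L (v i) = 1 →
      ∀ z : EuclideanSpace ℂ (Fin D), HasLineDerivAt ℝ (fun z => L (z i)) 1 z v := by
    intro L v hv z
    unfold HasLineDerivAt
    have : (fun t : ℝ => L ((z + t • v) i)) = fun t : ℝ => L (z i) + t * 1 := by
      funext t
      rw [PiLp.add_apply, PiLp.smul_apply, map_add, map_smul, hv, smul_eq_mul]
    rw [this]
    simpa using ((hasDerivAt_id (0 : ℝ)).mul_const 1).const_add (L (z i))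
  have kx := key (fun z => (z i).re) (EuclideanSpace.single i 1) (PolyGrowth.re_apply i)
    (fun l hl => by simp [hl]) (fun z => by simpa using hsq (z i) 1)
    (fun z => hlin Complex.reCLM _ (by simp) z)
  have ky := key (fun z => (z i).im) (EuclideanSpace.single i Complex.I) (PolyGrowth.im_apply i)
    (fun l hl => by simp [hl]) (fun z => by simpa using hsq (z i) Complex.I)
    (fun z => hlin Complex.imCLM _ (by simp) z)
  have hsum : gaussInt (fun z => 2 * (‖z i‖ ^ 2 * R z)) =
      -2 * gaussInt (fun z => g (quad lam z) * monoSq α z) := by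
    have e : (fun z : EuclideanSpace ℂ (Fin D) => 2 * (‖z i‖ ^ 2 * R z)) =
        fun z => (z i).re * (2 * (z i).re * R z) + (z i).im * (2 * (z i).im * R z) := by
      funext z
      rw [← Complex.normSq_eq_norm_sq, Complex.normSq_apply]; ring
    have px := PolyGrowth.re_apply i
    have py := PolyGrowth.im_apply i
    rw [e, gaussInt_add (px.mul (((PolyGrowth.const 2).mul px).mul hRp))
      (py.mul (((PolyGrowth.const 2).mul py).mul hRp)), kx, ky]
    ring
  have e : (fun z : EuclideanSpace ℂ (Fin D) => ‖z i‖ ^ 2 * (g (quad lam z) * monoSq α z)) =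
      fun z => lam i * (‖z i‖ ^ 2 * (g' (quad lam z) * monoSq α z))
        + (α i * (g (quad lam z) * monoSq α z) + (-1 / 2 : ℝ) * (2 * (‖z i‖ ^ 2 * R z))) := by
    funext z
    have hm : (α i : ℝ) * monoSq α z = ‖z i‖ ^ 2 * (α i * (‖z i‖ ^ 2) ^ (α i - 1)
            * ∏ l ∈ Finset.univ.erase i, (‖z l‖ ^ 2) ^ α l) := by
      rw [monoSq, ← Finset.mul_prod_erase _ _ (Finset.mem_univ i)]
      rcases Nat.eq_zero_or_pos (α i) with h | h
      · simp [h]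
      · obtain ⟨m, hm⟩ := Nat.exists_eq_succ_of_ne_zero h.ne'
        rw [hm, pow_succ]; simp; ring
    simp only [hR]
    linear_combination (-(g (quad lam z))) * hm
  rw [e, gaussInt_add ((PolyGrowth.const _).mul (hq.mul (hgp'.mul hw)))
      (((PolyGrowth.const _).mul hG).add ((PolyGrowth.const _).mul
        ((PolyGrowth.const _).mul (hq.mul hRp)))),
    gaussInt_add ((PolyGrowth.const _).mul hG) ((PolyGrowth.const _).mul
        ((PolyGrowth.const _).mul (hq.mul hRp))), gaussInt_const_mul, gaussInt_const_mul,
    gaussInt_const_mul (-1 / 2), hsum]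
  ring

end

/-! ### Gaussian moments of a quadratic form -/

section

variable {D : ℕ}

@[simp] lemma monoSq_zero (z : EuclideanSpace ℂ (Fin D)) : monoSq 0 z = 1 := by simp [monoSq]

/-- Stein's identity, averaged over the coordinates with the weights `λ_i`. -/
lemma gaussInt_quad_mul {lam : Fin D → ℝ} {g g' : ℝ → ℝ} (α : Fin D → ℕ) (hl : ∀ l, 0 ≤ lam l)
    (hsum : ∑ l, lam l = 1)
    (hg : ∀ y, 0 ≤ y → HasDerivAt g (g' y) y)
    (hgp : PolyGrowth fun z : EuclideanSpace ℂ (Fin D) => g (quad lam z))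
    (hgp' : PolyGrowth fun z : EuclideanSpace ℂ (Fin D) => g' (quad lam z)) :
    gaussInt (fun z => quad lam z * (g (quad lam z) * monoSq α z)) =
      (1 + ∑ i, lam i * α i) * gaussInt (fun z => g (quad lam z) * monoSq α z)
        + gaussInt (fun z => quad (fun i => lam i ^ 2) z * (g' (quad lam z) * monoSq α z)) := by
  have expand : ∀ (c : Fin D → ℝ) (F : EuclideanSpace ℂ (Fin D) → ℝ), PolyGrowth F →
      gaussInt (fun z => quad c z * F z) = ∑ i, c i * gaussInt (fun z => ‖z i‖ ^ 2 * F z) := by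
    intro c F hF
    simp only [quad, Finset.sum_mul, mul_assoc]
    rw [gaussInt_sum _ fun i => (PolyGrowth.const _).mul
      (((PolyGrowth.norm_apply i).pow 2).mul hF)]
    simp only [gaussInt_const_mul]
  rw [expand _ _ (hgp.mul (PolyGrowth.monoSq α)), expand _ _ (hgp'.mul (PolyGrowth.monoSq α))]
  have hone : 1 + ∑ i, lam i * (α i : ℝ) = ∑ i, lam i * (α i + 1) := by
    simp only [mul_add, mul_one, Finset.sum_add_distrib, hsum]
    ring
  simp only [gaussInt_stein α hl hg hgp hgp', hone, Finset.sum_mul, ← Finset.sum_add_distrib]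
  exact Finset.sum_congr rfl fun i _ => by ring

lemma gaussInt_quad_monoSq {lam : Fin D → ℝ} (α : Fin D → ℕ) (hl : ∀ l, 0 ≤ lam l)
    (hsum : ∑ l, lam l = 1) :
    gaussInt (fun z => quad lam z * monoSq α z) =
      (1 + ∑ i, lam i * α i) * gaussInt (monoSq α) := by
  have := gaussInt_quad_mul (g := fun _ => 1) (g' := fun _ => 0) α hl hsum
    (fun y _ => hasDerivAt_const _ _) (PolyGrowth.const 1) (PolyGrowth.const 0)
  simpa [gaussInt] using this

lemma gaussInt_quad_pow_succ {lam : Fin D → ℝ} (hl : ∀ l, 0 ≤ lam l)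
    (hsum : ∑ l, lam l = 1) (m : ℕ) :
    gaussInt (fun z => quad lam z ^ (m + 1)) = gaussInt (fun z => quad lam z ^ m)
      + m * gaussInt (fun z => quad (fun i => lam i ^ 2) z * quad lam z ^ (m - 1)) := by
  have := gaussInt_quad_mul (g := fun y => y ^ m) (g' := fun y => m * y ^ (m - 1)) 0 hl hsum
    (fun y _ => hasDerivAt_pow m y) ((PolyGrowth.quad lam).pow m)
    ((PolyGrowth.const _).mul ((PolyGrowth.quad lam).pow _))
  simp only [monoSq_zero, mul_one, Pi.zero_apply, Nat.cast_zero, mul_zero, Finset.sum_const_zero,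
    add_zero, one_mul] at this
  simp only [pow_succ', this, ← gaussInt_const_mul]
  congr 2
  funext z
  ring

lemma gaussInt_quad_sq {lam : Fin D → ℝ} (hl : ∀ l, 0 ≤ lam l) (hsum : ∑ l, lam l = 1) :
    gaussInt (fun z => quad lam z ^ 2) =
      (1 + ∑ i, lam i ^ 2) * gaussInt (fun _ : EuclideanSpace ℂ (Fin D) => 1) := by
  have h1 := gaussInt_quad_pow_succ hl hsum 1
  have h0 := gaussInt_quad_pow_succ hl hsum 0
  have h2 := gaussInt_stein (D := D) (lam := 0) (g := fun _ => 1) (g' := fun _ => 0) 0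
    (fun _ => le_rfl) (fun y _ => hasDerivAt_const _ _) (PolyGrowth.const 1) (PolyGrowth.const 0)
  simp only [monoSq_zero, mul_one, Pi.zero_apply, Nat.cast_zero, mul_zero, zero_mul,
    add_zero, zero_add, one_mul] at h2
  have h3 : gaussInt (fun z : EuclideanSpace ℂ (Fin D) => quad (fun i => lam i ^ 2) z) =
      (∑ i, lam i ^ 2) * gaussInt (fun _ : EuclideanSpace ℂ (Fin D) => 1) := by
    simp only [quad]
    rw [gaussInt_sum _ fun i => (PolyGrowth.const _).mul ((PolyGrowth.norm_apply i).pow 2)]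
    simp only [gaussInt_const_mul, h2, Finset.sum_mul]
  simp only [Nat.reduceAdd, Nat.cast_one, tsub_self, pow_zero, mul_one, one_mul, h3, zero_add,
    pow_one, Nat.cast_zero, zero_mul, add_zero] at h1 h0
  rw [h1, h0]
  ring

lemma quad_sq_le {lam : Fin D → ℝ} (hl : ∀ l, 0 ≤ lam l) {s : ℝ} (hs : ∀ l, lam l ≤ s)
    (z : EuclideanSpace ℂ (Fin D)) : quad (fun i => lam i ^ 2) z ≤ s * quad lam z := by
  rw [quad, quad, Finset.mul_sum]
  refine Finset.sum_le_sum fun l _ => ?_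
  have := mul_le_mul_of_nonneg_right (hs l) (hl l)
  rw [← mul_assoc, pow_two]
  gcongr

/-- Positive moments of the quadratic form: each Stein step costs a factor `1 + m ‖λ‖_∞`. -/
lemma gaussInt_quad_pow_le {lam : Fin D → ℝ} (hl : ∀ l, 0 ≤ lam l) (hsum : ∑ l, lam l = 1)
    {s : ℝ} (hs0 : 0 ≤ s) (hs : ∀ l, lam l ≤ s) (n : ℕ) :
    gaussInt (fun z => quad lam z ^ n) ≤
      (1 + n * s) ^ n * gaussInt (fun _ : EuclideanSpace ℂ (Fin D) => 1) := by
  have step : ∀ m : ℕ, gaussInt (fun z => quad lam z ^ (m + 1)) ≤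
      (1 + m * s) * gaussInt (fun z => quad lam z ^ m) := by
    intro m
    rw [gaussInt_quad_pow_succ hl hsum, add_mul, one_mul]
    rcases Nat.eq_zero_or_pos m with rfl | hm
    · simp
    rw [mul_assoc (m : ℝ)]
    gcongr
    rw [← gaussInt_const_mul]
    refine gaussInt_mono ((PolyGrowth.quad _).mul ((PolyGrowth.quad _).pow _))
      ((PolyGrowth.const _).mul ((PolyGrowth.quad _).pow _)) fun z => ?_
    calc _ ≤ s * quad lam z * quad lam z ^ (m - 1) :=
          mul_le_mul_of_nonneg_right (quad_sq_le hl hs z) (pow_nonneg (quad_nonneg hl z) _)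
      _ = _ := by rw [mul_assoc, ← pow_succ', Nat.sub_add_cancel hm]
  have main : ∀ m : ℕ, m ≤ n → gaussInt (fun z => quad lam z ^ m) ≤
      (1 + n * s) ^ m * gaussInt (fun _ : EuclideanSpace ℂ (Fin D) => 1) := by
    intro m
    induction m with
    | zero => intro _; simp
    | succ m ih =>
      intro hm
      have hmn : (m : ℝ) ≤ n := by exact_mod_cast (Nat.le_succ m).trans hm
      calc _ ≤ (1 + m * s) * gaussInt (fun z => quad lam z ^ m) := step m
        _ ≤ (1 + n * s) * ((1 + n * s) ^ m * gaussInt (fun _ : EuclideanSpace ℂ (Fin D) => 1)) := by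
            gcongr
            · exact gaussInt_nonneg fun z => pow_nonneg (quad_nonneg hl z) _
            · exact ih ((Nat.le_succ m).trans hm)
        _ = _ := by ring
  exact main n le_rfl

lemma PolyGrowth.inv_pow {lam : Fin D → ℝ} (hl : ∀ l, 0 ≤ lam l) {δ : ℝ} (hδ : 0 < δ) (j : ℕ) :
    PolyGrowth (fun z : EuclideanSpace ℂ (Fin D) => ((Scrooge.quad lam z + δ) ^ j)⁻¹) := by
  have hp : ∀ z : EuclideanSpace ℂ (Fin D), δ ≤ Scrooge.quad lam z + δ := fun z => by
    linarith [quad_nonneg hl z]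
  refine PolyGrowth.of_bounded ?_ ((δ ^ j)⁻¹) fun z => ?_
  · exact (((PolyGrowth.quad lam).1.add continuous_const).pow j).inv₀
      fun z => (pow_pos (hδ.trans_le (hp z)) j).ne'
  · have h1 : 0 < (Scrooge.quad lam z + δ) ^ j := pow_pos (hδ.trans_le (hp z)) j
    rw [abs_of_pos (inv_pos.2 h1)]
    have := hp z
    gcongr

/-- Negative moments of the regularized quadratic form, in the law weighted by `|z ^ α| ^ 2`: each
Stein step costs a factor `1 - j ‖λ‖_∞`, the contribution of the weight having the good sign. -/
lemma gaussInt_inv_pow_regularized_le {lam : Fin D → ℝ} (α : Fin D → ℕ) (hl : ∀ l, 0 ≤ lam l)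
    (hsum : ∑ l, lam l = 1) {s : ℝ} (hs0 : 0 ≤ s) (hs : ∀ l, lam l ≤ s) {δ : ℝ} (hδ : 0 < δ)
    (n : ℕ) (hn : n * s ≤ 1) :
    (1 - n * s) ^ n * gaussInt (fun z => ((quad lam z + δ) ^ n)⁻¹ * monoSq α z) ≤
      gaussInt (monoSq α) := by
  have hw := PolyGrowth.monoSq α
  set b : ℕ → ℝ := fun j => gaussInt (fun z => ((quad lam z + δ) ^ j)⁻¹ * monoSq α z) with hb
  have hpos : ∀ z : EuclideanSpace ℂ (Fin D), 0 < quad lam z + δ := fun z => by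
    linarith [quad_nonneg hl z]
  have hb0 : ∀ j, 0 ≤ b j := fun j => gaussInt_nonneg fun z =>
    mul_nonneg (inv_nonneg.2 (pow_nonneg (hpos z).le _)) (monoSq_nonneg α z)
  have step : ∀ j : ℕ, (1 - (j + 1 : ℕ) * s) * b (j + 1) ≤ b j := by
    intro j
    have hst := gaussInt_quad_mul (g := fun y => ((y + δ) ^ (j + 1))⁻¹)
      (g' := fun y => -((j + 1 : ℕ) : ℝ) * ((y + δ) ^ (j + 2))⁻¹) α hl hsum
      (fun y hy => by
        have hyd : y + δ ≠ 0 := by positivity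
        have := (((hasDerivAt_id y).add_const δ).pow (j + 1)).inv (pow_ne_zero _ hyd)
        refine this.congr_deriv ?_
        simp only [id, Pi.pow_apply, Nat.add_sub_cancel]
        field_simp
        ring)
      (PolyGrowth.inv_pow hl hδ _) ((PolyGrowth.const _).mul (PolyGrowth.inv_pow hl hδ _))
    have hQ := PolyGrowth.quad (D := D) (fun i => lam i ^ 2)
    have h1 : gaussInt (fun z => quad lam z * (((quad lam z + δ) ^ (j + 1))⁻¹ * monoSq α z)) ≤
        b j := by
      refine gaussInt_mono ((PolyGrowth.quad _).mul ((PolyGrowth.inv_pow hl hδ _).mul hw))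
        ((PolyGrowth.inv_pow hl hδ _).mul hw) fun z => ?_
      rw [← mul_assoc]
      refine mul_le_mul_of_nonneg_right ?_ (monoSq_nonneg α z)
      have := hpos z
      rw [pow_succ, mul_inv, mul_comm, mul_assoc]
      refine mul_le_of_le_one_right (by positivity) ?_
      rw [inv_mul_le_iff₀ (hpos z)]
      linarith
    have h2 : -((j + 1 : ℕ) * s) * b (j + 1) ≤ gaussInt (fun z => quad (fun i => lam i ^ 2) z *
        (-((j + 1 : ℕ) : ℝ) * ((quad lam z + δ) ^ (j + 2))⁻¹ * monoSq α z)) := by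
      rw [hb, ← gaussInt_const_mul]
      refine gaussInt_mono ((PolyGrowth.const _).mul ((PolyGrowth.inv_pow hl hδ _).mul hw))
        (hQ.mul (((PolyGrowth.const _).mul (PolyGrowth.inv_pow hl hδ _)).mul hw)) fun z => ?_
      have h3 : quad (fun i => lam i ^ 2) z * ((quad lam z + δ) ^ (j + 2))⁻¹ ≤
          s * ((quad lam z + δ) ^ (j + 1))⁻¹ := by
        have := hpos z
        rw [← div_eq_mul_inv, ← div_eq_mul_inv, div_le_div_iff₀ (by positivity) (by positivity),
          pow_succ _ (j + 1), mul_comm (_ ^ (j + 1)), ← mul_assoc]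
        refine mul_le_mul_of_nonneg_right ?_ (by positivity)
        have := quad_sq_le hl hs z
        nlinarith
      have h4 := mul_le_mul_of_nonneg_left h3
        (mul_nonneg (Nat.cast_nonneg (α := ℝ) (j + 1)) (monoSq_nonneg α z))
      linarith
    have h5 : 0 ≤ ∑ i, lam i * α i :=
      Finset.sum_nonneg fun i _ => mul_nonneg (hl i) (Nat.cast_nonneg _)
    have h6 := mul_nonneg h5 (hb0 (j + 1))
    have h7 : gaussInt (fun z => quad lam z * (((quad lam z + δ) ^ (j + 1))⁻¹ * monoSq α z)) =
        (1 + ∑ i, lam i * α i) * b (j + 1) + gaussInt (fun z => quad (fun i => lam i ^ 2) z *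
        (-((j + 1 : ℕ) : ℝ) * ((quad lam z + δ) ^ (j + 2))⁻¹ * monoSq α z)) := hst
    linarith
  have main : ∀ j ≤ n, (1 - n * s) ^ j * b j ≤ b 0 := by
    intro j
    induction j with
    | zero => intro _; simp
    | succ j ih =>
      intro hj
      have hjn : ((j + 1 : ℕ) : ℝ) ≤ n := by exact_mod_cast hj
      calc (1 - n * s) ^ (j + 1) * b (j + 1)
          = (1 - n * s) ^ j * ((1 - n * s) * b (j + 1)) := by ring
        _ ≤ (1 - n * s) ^ j * b j := by
          refine mul_le_mul_of_nonneg_left (le_trans ?_ (step j)) (pow_nonneg (by linarith) _)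
          have := hb0 (j + 1)
          gcongr
        _ ≤ b 0 := ih ((Nat.le_succ j).trans hj)
  have hbz : b 0 = gaussInt (monoSq α) := by simp [hb]
  exact hbz ▸ main n le_rfl

lemma measurable_quad (lam : Fin D → ℝ) : Measurable (quad (D := D) lam) :=
  (PolyGrowth.quad lam).1.measurable

lemma measurable_monoSq (α : Fin D → ℕ) : Measurable (monoSq (D := D) α) :=
  (PolyGrowth.monoSq α).1.measurable

/-- Negative moments of the quadratic form, by letting the regularization tend to zero. -/
lemma gaussInt_inv_pow_le {lam : Fin D → ℝ} (α : Fin D → ℕ) (hl : ∀ l, 0 ≤ lam l)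
    (hsum : ∑ l, lam l = 1) {s : ℝ} (hs0 : 0 ≤ s) (hs : ∀ l, lam l ≤ s)
    (n : ℕ) (hn : n * s < 1) :
    Integrable (fun z => (quad lam z ^ n)⁻¹ * monoSq α z * Real.exp (-‖z‖ ^ 2)) ∧
    gaussInt (fun z => (quad lam z ^ n)⁻¹ * monoSq α z) ≤
      ((1 - n * s) ^ n)⁻¹ * gaussInt (monoSq α) := by
  set δ : ℕ → ℝ := fun p => 1 / ((p : ℝ) + 1) with hδ
  have hδ0 : ∀ p, 0 < δ p := fun p => by positivity
  have hr : 0 < (1 - n * s) ^ n := pow_pos (by linarith) _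
  set B := ((1 - n * s) ^ n)⁻¹ * gaussInt (monoSq α) with hB
  have hB0 : 0 ≤ B := mul_nonneg (inv_nonneg.2 hr.le) (gaussInt_nonneg (monoSq_nonneg α))
  set F : EuclideanSpace ℂ (Fin D) → ℝ :=
    fun z => (quad lam z ^ n)⁻¹ * monoSq α z * Real.exp (-‖z‖ ^ 2) with hF
  set Fp : ℕ → EuclideanSpace ℂ (Fin D) → ℝ :=
    fun p z => ((quad lam z + δ p) ^ n)⁻¹ * monoSq α z * Real.exp (-‖z‖ ^ 2) with hFp
  have hF0 : ∀ z, 0 ≤ F z := fun z => mul_nonneg (mul_nonneg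
    (inv_nonneg.2 (pow_nonneg (quad_nonneg hl z) _)) (monoSq_nonneg α z)) (Real.exp_pos _).le
  have hFp0 : ∀ p z, 0 ≤ Fp p z := fun p z => mul_nonneg (mul_nonneg
    (inv_nonneg.2 (pow_nonneg (by linarith [quad_nonneg hl z, hδ0 p]) _)) (monoSq_nonneg α z))
      (Real.exp_pos _).le
  have hFm : Measurable F := by
    have := measurable_quad (D := D) lam
    have := measurable_monoSq (D := D) α
    fun_prop
  have hFpm : ∀ p, Measurable (Fp p) := fun p => by
    have := measurable_quad (D := D) lam
    have := measurable_monoSq (D := D) α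
    fun_prop
  have hbound : ∀ p, ∫⁻ z, ENNReal.ofReal (Fp p z) ≤ ENNReal.ofReal B := by
    intro p
    rw [← ofReal_integral_eq_lintegral_ofReal
      ((PolyGrowth.inv_pow hl (hδ0 p) n).mul (PolyGrowth.monoSq α)).integrable
      (ae_of_all _ (hFp0 p))]
    refine ENNReal.ofReal_le_ofReal ?_
    rw [hB, le_inv_mul_iff₀ hr]
    exact gaussInt_inv_pow_regularized_le α hl hsum hs0 hs (hδ0 p) n hn.le
  have hlim : ∀ z, ENNReal.ofReal (F z) ≤
      Filter.liminf (fun p => ENNReal.ofReal (Fp p z)) Filter.atTop := by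
    intro z
    rcases (quad_nonneg hl z).eq_or_lt with h | h
    · rcases Nat.eq_zero_or_pos n with hn0 | hn0
      · simp [hF, hFp, hn0]
      · simp [hF, ← h, hn0.ne']
    · have hd : Filter.Tendsto δ Filter.atTop (nhds 0) := tendsto_one_div_add_atTop_nhds_zero_nat
      have : Filter.Tendsto (fun p => Fp p z) Filter.atTop (nhds (F z)) := by
        have h1 : Filter.Tendsto (fun p => quad lam z + δ p) Filter.atTop (nhds (quad lam z)) := by
          simpa using hd.const_add (quad lam z)
        exact (((h1.pow n).inv₀ (pow_ne_zero _ h.ne')).mul_const _).mul_const _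
      exact ((ENNReal.continuous_ofReal.tendsto _).comp this).liminf_eq.ge
  have hle : ∫⁻ z, ENNReal.ofReal (F z) ≤ ENNReal.ofReal B :=
    calc _ ≤ ∫⁻ z, Filter.liminf (fun p => ENNReal.ofReal (Fp p z)) Filter.atTop :=
          lintegral_mono hlim
      _ ≤ Filter.liminf (fun p => ∫⁻ z, ENNReal.ofReal (Fp p z)) Filter.atTop :=
          lintegral_liminf_le fun p => (hFpm p).ennreal_ofReal
      _ ≤ ENNReal.ofReal B := by
          refine Filter.liminf_le_of_le (by isBoundedDefault) fun b hb => ?_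
          obtain ⟨p, hp⟩ := hb.exists
          exact hp.trans (hbound p)
  refine ⟨⟨hFm.aestronglyMeasurable, ?_⟩, ?_⟩
  · rw [hasFiniteIntegral_iff_ofReal (ae_of_all _ hF0)]
    exact hle.trans_lt ENNReal.ofReal_lt_top
  · rw [gaussInt, integral_eq_lintegral_of_nonneg_ae (ae_of_all _ hF0) hFm.aestronglyMeasurable]
    exact ENNReal.toReal_le_of_le_ofReal hB0 hle

end

/-! ### Polar coordinates and the Haar measure on the sphere -/

section

variable {D : ℕ}

lemma integral_haar {F : Type*} [NormedAddCommGroup F] [NormedSpace ℝ F]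
    (f : EuclideanSpace ℂ (Fin D) → F) :
    ∫ φ, f φ ∂haar D = ((volume : Measure (EuclideanSpace ℂ (Fin D))).toSphere.real Set.univ)⁻¹ •
      ∫ x, f x ∂(volume : Measure (EuclideanSpace ℂ (Fin D))).toSphere := by
  rw [haar, (MeasurableEmbedding.subtype_coe Metric.isClosed_sphere.measurableSet).integral_map,
    integral_smul_measure]
  simp [Measure.real]

lemma ae_haar_norm_eq_one : ∀ᵐ φ ∂haar D, ‖φ‖ = 1 := by
  rw [haar, (MeasurableEmbedding.subtype_coe Metric.isClosed_sphere.measurableSet).ae_map_iff]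
  exact ae_of_all _ fun x => by simp

/-- A function homogeneous of degree `2 m`, times the Gaussian weight, in polar coordinates. -/
lemma integrable_toSphere_and_integral_eq_mul {E : Type*} [NormedAddCommGroup E] [NormedSpace ℝ E]
    [MeasurableSpace E] [BorelSpace E] [FiniteDimensional ℝ E] [Nontrivial E]
    (μ : Measure E) [μ.IsAddHaarMeasure] {F : E → ℝ} {m : ℕ}
    (hF : ∀ (r : ℝ) (z : E), 0 < r → F (r • z) = r ^ (2 * m) * F z) :
    (Integrable (fun z => F z * Real.exp (-‖z‖ ^ 2)) μ →
        Integrable (fun x : Metric.sphere (0 : E) 1 => F x) μ.toSphere) ∧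
      ∫ z, F z * Real.exp (-‖z‖ ^ 2) ∂μ = (∫ x, F x ∂μ.toSphere) *
      ∫ r : Set.Ioi (0 : ℝ), (r : ℝ) ^ (2 * m) * Real.exp (-(r : ℝ) ^ 2)
        ∂(Measure.volumeIoiPow (Module.finrank ℝ E - 1)) := by
  set f : E → ℝ := fun z => F z * Real.exp (-‖z‖ ^ 2) with hf
  set g : Set.Ioi (0 : ℝ) → ℝ := fun r => (r : ℝ) ^ (2 * m) * Real.exp (-(r : ℝ) ^ 2) with hg
  have hmp := μ.measurePreserving_homeomorphUnitSphereProd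
  have hme := (homeomorphUnitSphereProd E).measurableEmbedding
  have hfe : ∀ x : ({0}ᶜ : Set E), f x = F (homeomorphUnitSphereProd E x).1 *
      g (homeomorphUnitSphereProd E x).2 := by
    intro x
    have hx : (x : E) = ((homeomorphUnitSphereProd E x).2 : ℝ) •
        ((homeomorphUnitSphereProd E x).1 : E) := by
      rw [← homeomorphUnitSphereProd_symm_apply_coe, Homeomorph.symm_apply_apply]
    have hr : 0 < ((homeomorphUnitSphereProd E x).2 : ℝ) :=
      (homeomorphUnitSphereProd E x).2.2
    have hn : ‖(x : E)‖ = ((homeomorphUnitSphereProd E x).2 : ℝ) := by simp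
    simp only [hf, hg]
    rw [hn]
    conv_lhs => rw [hx, hF _ _ hr]
    ring
  have hms : MeasurableSet ({0}ᶜ : Set E) := (measurableSet_singleton _).compl
  constructor
  · intro hi
    have h1 : Integrable (fun p : Metric.sphere (0 : E) 1 × Set.Ioi (0 : ℝ) => F p.1 * g p.2)
        (μ.toSphere.prod (Measure.volumeIoiPow (Module.finrank ℝ E - 1))) := by
      rw [← hmp.integrable_comp_emb hme]
      have h2 := (integrableOn_iff_comap_subtypeVal hms).1 hi.integrableOn
      exact h2.congr (ae_of_all _ hfe)
    have hne : Measure.volumeIoiPow (Module.finrank ℝ E - 1) ≠ 0 := by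
      intro h0
      have := Measure.volumeIoiPow_apply_Iio (Module.finrank ℝ E - 1)
        ⟨1, Set.mem_Ioi.2 one_pos⟩
      rw [h0] at this
      have h3 : (0 : ℝ) <
          1 ^ (Module.finrank ℝ E - 1 + 1) / ((Module.finrank ℝ E - 1 : ℕ) + 1) := by
        positivity
      exact (ENNReal.ofReal_pos.2 h3).ne this
    have : (ae (Measure.volumeIoiPow (Module.finrank ℝ E - 1))).NeBot := ae_neBot.2 hne
    obtain ⟨r, hr⟩ := h1.prod_left_ae.exists
    have hgr : g r ≠ 0 := (mul_pos (pow_pos r.2 _) (Real.exp_pos _)).ne'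
    exact (integrable_mul_const_iff (isUnit_iff_ne_zero.2 hgr) _).1 hr
  · rw [← integral_prod_mul, ← hmp.integral_comp hme]
    calc ∫ z, f z ∂μ = ∫ x : ({0}ᶜ : Set E), f x ∂(Measure.comap Subtype.val μ) := by
          rw [integral_subtype_comap hms, restrict_compl_singleton]
      _ = _ := integral_congr_ae (ae_of_all _ hfe)

open scoped Pointwise in
/-- The Haar measure on the sphere is invariant under linear isometries. -/
lemma map_isometry_haar (L : EuclideanSpace ℂ (Fin D) ≃ₗᵢ[ℝ] EuclideanSpace ℂ (Fin D)) :
    (haar D).map L = haar D := by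
  have hL : Measurable L := L.continuous.measurable
  have hLp : MeasurePreserving L.toMeasurableEquiv volume volume := L.measurePreserving
  ext A hA
  rw [Measure.map_apply hL hA, haar, Measure.map_apply measurable_subtype_coe (hL hA),
    Measure.map_apply measurable_subtype_coe hA, Measure.smul_apply, Measure.smul_apply,
    Measure.toSphere_apply' _ (measurable_subtype_coe (hL hA)),
    Measure.toSphere_apply' _ (measurable_subtype_coe hA),
    ← hLp.measure_preimage_equiv
      (Set.Ioo (0 : ℝ) 1 • (Subtype.val '' (Subtype.val ⁻¹' A :
        Set (Metric.sphere (0 : EuclideanSpace ℂ (Fin D)) 1))))]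
  congr 3
  ext z
  simp only [Set.mem_smul, Set.mem_image, Set.mem_preimage, Subtype.exists,
    mem_sphere_zero_iff_norm, exists_and_left, exists_prop, exists_eq_right_right]
  constructor
  · rintro ⟨r, hr, y, ⟨hy, hy1⟩, rfl⟩
    exact ⟨r, hr, L y, ⟨hy, by simpa using hy1⟩, (map_smul L r y).symm⟩
  · rintro ⟨r, hr, y, ⟨hy, hy1⟩, h⟩
    refine ⟨r, hr, L.symm y, ⟨by simpa using hy, by simpa using hy1⟩, ?_⟩
    rw [← map_smul, h]
    exact L.symm_apply_apply z

variable [NeZero D]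

instance : IsProbabilityMeasure (haar D) := by
  constructor
  have h := (volume : Measure (EuclideanSpace ℂ (Fin D))).toSphere_ne_zero
  rw [haar, Measure.map_apply measurable_subtype_coe MeasurableSet.univ, Set.preimage_univ]
  simp only [Measure.smul_apply, smul_eq_mul]
  exact ENNReal.inv_mul_cancel (Measure.measure_univ_ne_zero.2 h) (measure_ne_top _ _)

lemma integrable_haar_of_homogeneous {F : EuclideanSpace ℂ (Fin D) → ℝ} {m : ℕ}
    (hF : ∀ (r : ℝ) (z : EuclideanSpace ℂ (Fin D)), 0 < r → F (r • z) = r ^ (2 * m) * F z)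
    (h : Integrable (fun z => F z * Real.exp (-‖z‖ ^ 2))) : Integrable F (haar D) := by
  rw [haar,
    (MeasurableEmbedding.subtype_coe Metric.isClosed_sphere.measurableSet).integrable_map_iff]
  refine ((integrable_toSphere_and_integral_eq_mul volume hF).1 h).smul_measure
    (ENNReal.inv_ne_top.2 ?_)
  exact Measure.measure_univ_ne_zero.2 (Measure.toSphere_ne_zero volume)

/-- Integrals over the sphere and Gaussian integrals of a function homogeneous of degree `2 m`
differ by the factor `E ‖z‖ ^ (2 m)`. -/
lemma gaussInt_eq_mul_integral_haar {F : EuclideanSpace ℂ (Fin D) → ℝ} {m : ℕ}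
    (hF : ∀ (r : ℝ) (z : EuclideanSpace ℂ (Fin D)), 0 < r → F (r • z) = r ^ (2 * m) * F z) :
    gaussInt F = gaussInt (fun z : EuclideanSpace ℂ (Fin D) => (‖z‖ ^ 2) ^ m) *
      ∫ φ, F φ ∂haar D := by
  have h0 := (integrable_toSphere_and_integral_eq_mul
    (volume : Measure (EuclideanSpace ℂ (Fin D))) (F := fun z => (‖z‖ ^ 2) ^ m) (m := m)
    fun r z hr => by
      rw [norm_smul, Real.norm_of_nonneg hr.le, mul_pow, mul_pow, ← pow_mul]).2
  have hne : (volume : Measure (EuclideanSpace ℂ (Fin D))).toSphere.real Set.univ ≠ 0 := by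
    rw [Measure.real, ENNReal.toReal_ne_zero]
    exact ⟨Measure.measure_univ_ne_zero.2 (Measure.toSphere_ne_zero _), measure_ne_top _ _⟩
  have h1 : (∫ x : Metric.sphere (0 : EuclideanSpace ℂ (Fin D)) 1,
      (‖(x : EuclideanSpace ℂ (Fin D))‖ ^ 2) ^ m
      ∂(volume : Measure (EuclideanSpace ℂ (Fin D))).toSphere) =
      (volume : Measure (EuclideanSpace ℂ (Fin D))).toSphere.real Set.univ := by
    simp
  rw [gaussInt, gaussInt, h0, h1, (integrable_toSphere_and_integral_eq_mul volume hF).2,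
    integral_haar, smul_eq_mul]
  field_simp

end

/-! ### Moments of `D ⟨φ|σ|φ⟩` under the Haar measure -/

section

variable {D : ℕ}

lemma quad_smul (lam : Fin D → ℝ) (r : ℝ) (z : EuclideanSpace ℂ (Fin D)) :
    quad lam (r • z) = r ^ 2 * quad lam z := by
  simp only [quad, PiLp.smul_apply, norm_smul, Real.norm_eq_abs, mul_pow, sq_abs, Finset.mul_sum]
  exact Finset.sum_congr rfl fun l _ => by ring

lemma monoSq_smul (α : Fin D → ℕ) (r : ℝ) (z : EuclideanSpace ℂ (Fin D)) :
    monoSq α (r • z) = r ^ (2 * ∑ l, α l) * monoSq α z := by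
  simp only [monoSq, PiLp.smul_apply, norm_smul, Real.norm_eq_abs, mul_pow, sq_abs,
    Finset.prod_mul_distrib, Finset.prod_pow_eq_pow_sum, pow_mul]

/-- The Gaussian moment `∫ ‖z‖ ^ (2 m) exp (-‖z‖ ^ 2)`. -/
def radialMoment (D m : ℕ) : ℝ :=
  gaussInt (fun z : EuclideanSpace ℂ (Fin D) => (‖z‖ ^ 2) ^ m)

lemma radialMoment_zero :
    radialMoment D 0 = gaussInt (fun _ : EuclideanSpace ℂ (Fin D) => 1) := by
  simp [radialMoment]

lemma radialMoment_zero_pos : 0 < radialMoment D 0 := by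
  rw [radialMoment_zero]
  have hi := (PolyGrowth.const (D := D) 1).integrable
  rw [gaussInt, integral_pos_iff_support_of_nonneg (fun z => by positivity) hi]
  have : Function.support (fun z : EuclideanSpace ℂ (Fin D) => 1 * Real.exp (-‖z‖ ^ 2)) =
      Set.univ := Set.eq_univ_of_forall fun z => by
    simp
  rw [this]
  exact isOpen_univ.measure_pos _ Set.univ_nonempty

variable [NeZero D]

lemma natCast_D_pos : (0 : ℝ) < D := Nat.cast_pos.2 (NeZero.pos D)

/-- Stein's identity for the uniform weights `λ_i = 1 / D`. -/
lemma radialMoment_succ (m : ℕ) : radialMoment D (m + 1) = (D + m) * radialMoment D m := by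
  have hD := natCast_D_pos (D := D)
  have hq : ∀ c : ℝ, quad (D := D) (fun _ => c) = fun z => c * ‖z‖ ^ 2 := by
    intro c
    funext z
    rw [quad, EuclideanSpace.norm_sq_eq, Finset.mul_sum]
  have h := gaussInt_quad_pow_succ (D := D) (lam := fun _ => (D : ℝ)⁻¹)
    (fun _ => (inv_pos.2 hD).le) (by simp [hD.ne']) m
  simp only [hq, mul_pow, gaussInt_const_mul] at h
  have h2 : (m : ℝ) * gaussInt (fun z : EuclideanSpace ℂ (Fin D) =>
      ((D : ℝ)⁻¹ ^ 2 * ‖z‖ ^ 2) * (((D : ℝ)⁻¹) ^ (m - 1) * (‖z‖ ^ 2) ^ (m - 1))) =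
      m * ((D : ℝ)⁻¹ ^ (m + 1) * radialMoment D m) := by
    rcases Nat.eq_zero_or_pos m with rfl | hm
    · simp
    obtain ⟨p, rfl⟩ := Nat.exists_eq_succ_of_ne_zero hm.ne'
    rw [radialMoment, ← gaussInt_const_mul (_ ^ _)]
    congr 2
    funext z
    simp only [Nat.succ_eq_add_one, Nat.add_sub_cancel]
    ring
  rw [h2] at h
  change (D : ℝ)⁻¹ ^ (m + 1) * radialMoment D (m + 1) = (D : ℝ)⁻¹ ^ m * radialMoment D m + _ at h
  have hp : ((D : ℝ)⁻¹) ^ m ≠ 0 := pow_ne_zero _ (inv_ne_zero hD.ne')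
  refine mul_left_cancel₀ (mul_ne_zero hp (inv_ne_zero hD.ne')) ?_
  rw [← pow_succ, h, pow_succ]
  field_simp

lemma radialMoment_pos (m : ℕ) : 0 < radialMoment D m := by
  have hD := natCast_D_pos (D := D)
  induction m with
  | zero => exact radialMoment_zero_pos
  | succ m ih => rw [radialMoment_succ]; positivity

lemma radialMoment_add_le (m n : ℕ) :
    radialMoment D (m + n) ≤ (D + (m + n : ℕ)) ^ n * radialMoment D m := by
  have hD := natCast_D_pos (D := D)
  have : ∀ j ≤ n, radialMoment D (m + j) ≤ (D + (m + n : ℕ)) ^ j * radialMoment D m := by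
    intro j
    induction j with
    | zero => intro _; simp
    | succ j ih =>
      intro hj
      have h1 : ((m + j : ℕ) : ℝ) ≤ (m + n : ℕ) := by exact_mod_cast by omega
      have := ih (by omega)
      have h2 := radialMoment_pos (D := D) (m + j)
      rw [← add_assoc, radialMoment_succ, pow_succ', mul_assoc]
      gcongr
  exact this n le_rfl

lemma pow_mul_radialMoment_zero_le (m : ℕ) :
    (D : ℝ) ^ m * radialMoment D 0 ≤ radialMoment D m := by
  have hD := natCast_D_pos (D := D)
  induction m with
  | zero => simp
  | succ m ih =>
    rw [radialMoment_succ, pow_succ', mul_assoc]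
    have := radialMoment_pos (D := D) m
    have hm := Nat.cast_nonneg (α := ℝ) m
    calc _ ≤ (D : ℝ) * radialMoment D m := by gcongr
      _ ≤ _ := by gcongr; linarith

lemma gaussInt_eq_radialMoment_mul {F : EuclideanSpace ℂ (Fin D) → ℝ} {m : ℕ}
    (hF : ∀ (r : ℝ) (z : EuclideanSpace ℂ (Fin D)), 0 < r → F (r • z) = r ^ (2 * m) * F z) :
    gaussInt F = radialMoment D m * ∫ φ, F φ ∂haar D :=
  gaussInt_eq_mul_integral_haar hF

lemma integrable_haar_monoSq (α : Fin D → ℕ) : Integrable (monoSq α) (haar D) :=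
  integrable_haar_of_homogeneous (fun r z _ => monoSq_smul α r z) (PolyGrowth.monoSq α).integrable

lemma integrable_haar_quad_mul_monoSq (lam : Fin D → ℝ) (α : Fin D → ℕ) :
    Integrable (fun z => quad lam z * monoSq α z) (haar D) :=
  integrable_haar_of_homogeneous (m := ∑ l, α l + 1)
    (fun r z _ => by rw [quad_smul, monoSq_smul]; ring)
    ((PolyGrowth.quad lam).mul (PolyGrowth.monoSq α)).integrable

lemma integrable_haar_quad_pow (lam : Fin D → ℝ) (m : ℕ) :
    Integrable (fun z => quad lam z ^ m) (haar D) :=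
  integrable_haar_of_homogeneous (m := m)
    (fun r z _ => by rw [quad_smul, mul_pow, ← pow_mul])
    ((PolyGrowth.quad lam).pow m).integrable

/-- A coordinate hyperplane is a null set for the Haar measure. -/
lemma ae_haar_apply_ne_zero (i : Fin D) : ∀ᵐ φ ∂haar D, φ i ≠ 0 := by
  set A : Set (EuclideanSpace ℂ (Fin D)) := {z | z i = 0} with hA
  have hAm : MeasurableSet A := (isClosed_singleton.preimage (by fun_prop : Continuous
    fun z : EuclideanSpace ℂ (Fin D) => z i)).measurableSet
  have hvol : volume A = 0 := by
    set p : Submodule ℝ (EuclideanSpace ℂ (Fin D)) :=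
      { carrier := A
        add_mem' := fun {a b} ha hb => by
          simp only [hA, Set.mem_ofPred_eq] at *; simp [ha, hb]
        zero_mem' := by simp [hA]
        smul_mem' := fun c x hx => by simp only [hA, Set.mem_ofPred_eq] at *; simp [hx] } with hp
    have : p ≠ ⊤ := by
      intro h
      have h1 : EuclideanSpace.single i (1 : ℂ) ∈ p := h ▸ Submodule.mem_top
      have h2 : EuclideanSpace.single i (1 : ℂ) i = 0 := h1
      simp at h2
    exact Measure.addHaar_submodule volume p this
  have h1 : gaussInt (A.indicator fun _ => 1) = radialMoment D 0 *
      ∫ φ, A.indicator (fun _ => (1 : ℝ)) φ ∂haar D := by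
    refine gaussInt_eq_radialMoment_mul fun r z hr => ?_
    have : r • z ∈ A ↔ z ∈ A := by simp [hA, hr.ne']
    by_cases hz : z ∈ A
    · simp [hz, this.2 hz]
    · simp [hz, mt this.1 hz]
  have h2 : gaussInt (A.indicator fun _ => (1 : ℝ)) = 0 := by
    refine integral_eq_zero_of_ae ?_
    have : ∀ᵐ z : EuclideanSpace ℂ (Fin D), z ∉ A := measure_eq_zero_iff_ae_notMem.1 hvol
    filter_upwards [this] with z hz
    simp [hz]
  rw [h2, integral_indicator hAm] at h1
  have h3 := (mul_eq_zero.1 h1.symm).resolve_left radialMoment_zero_pos.ne'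
  have h4 : haar D A = 0 := by
    simpa [Measure.real, ENNReal.toReal_eq_zero_iff, measure_ne_top] using h3
  exact measure_eq_zero_iff_ae_notMem.1 h4

lemma ae_haar_quad_pos {lam : Fin D → ℝ} (hl : ∀ l, 0 ≤ lam l) (hsum : ∑ l, lam l = 1) :
    ∀ᵐ φ ∂haar D, 0 < quad lam φ := by
  obtain ⟨i, hi⟩ : ∃ i, lam i ≠ 0 := by
    by_contra! h
    simp [h] at hsum
  filter_upwards [ae_haar_apply_ne_zero i] with φ hφ
  have : 0 < lam i * ‖φ i‖ ^ 2 :=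
    mul_pos ((hl i).lt_of_ne' hi) (pow_pos (norm_pos_iff.2 hφ) 2)
  exact this.trans_le (Finset.single_le_sum (f := fun l => lam l * ‖φ l‖ ^ 2)
    (fun l _ => mul_nonneg (hl l) (by positivity)) (Finset.mem_univ i))

lemma integral_haar_quad_inv_pow_le {lam : Fin D → ℝ} {α : Fin D → ℕ} (hl : ∀ l, 0 ≤ lam l)
    (hsum : ∑ l, lam l = 1) {s : ℝ} (hs0 : 0 ≤ s) (hs : ∀ l, lam l ≤ s)
    {n : ℕ} (hn : n * s < 1) (hα : ∑ l, α l = n + 1) :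
    Integrable (fun z => (quad lam z ^ n)⁻¹ * monoSq α z) (haar D) ∧
    ∫ φ, (quad lam φ ^ n)⁻¹ * monoSq α φ ∂haar D ≤
      ((1 - n * s) ^ n)⁻¹ * (D + (n + 1 : ℕ)) ^ n * ∫ φ, monoSq α φ ∂haar D := by
  obtain ⟨h1, h2⟩ := gaussInt_inv_pow_le α hl hsum hs0 hs n hn
  have hhom : ∀ (r : ℝ) (z : EuclideanSpace ℂ (Fin D)), 0 < r →
      (quad lam (r • z) ^ n)⁻¹ * monoSq α (r • z) =
        r ^ (2 * 1) * ((quad lam z ^ n)⁻¹ * monoSq α z) := by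
    intro r z hr
    rw [quad_smul, monoSq_smul, hα, mul_pow, mul_inv, ← pow_mul, mul_add, pow_add]
    have : r ^ (2 * n) ≠ 0 := (pow_pos hr _).ne'
    field_simp
  refine ⟨integrable_haar_of_homogeneous hhom h1, ?_⟩
  rw [gaussInt_eq_radialMoment_mul hhom,
    gaussInt_eq_radialMoment_mul (F := monoSq α) (fun r z _ => monoSq_smul α r z), hα] at h2
  have hw : 0 ≤ ∫ φ, monoSq α φ ∂haar D := integral_nonneg fun z => monoSq_nonneg α z
  have h3 := radialMoment_add_le (D := D) 1 n
  rw [add_comm 1 n] at h3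
  have hr : 0 < ((1 - n * s) ^ n)⁻¹ := inv_pos.2 (pow_pos (by linarith) _)
  refine le_of_mul_le_mul_left (h2.trans ?_) (radialMoment_pos 1)
  calc _ ≤ ((1 - n * s) ^ n)⁻¹ * ((D + (n + 1 : ℕ)) ^ n * radialMoment D 1
        * ∫ φ, monoSq α φ ∂haar D) := by gcongr
    _ = _ := by ring

lemma mul_integral_haar_quad_mul_le {lam : Fin D → ℝ} (α : Fin D → ℕ) (hl : ∀ l, 0 ≤ lam l)
    (hsum : ∑ l, lam l = 1) {s : ℝ} (hs : ∀ l, lam l ≤ s) :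
    D * ∫ φ, quad lam φ * monoSq α φ ∂haar D ≤
      (1 + (∑ l, α l : ℕ) * s) * ∫ φ, monoSq α φ ∂haar D := by
  have hD := natCast_D_pos (D := D)
  have h := gaussInt_quad_monoSq α hl hsum
  rw [gaussInt_eq_radialMoment_mul (m := ∑ l, α l + 1)
      (F := fun z => quad lam z * monoSq α z)
      (fun r z _ => by rw [quad_smul, monoSq_smul]; ring),
    gaussInt_eq_radialMoment_mul (F := monoSq α) (fun r z _ => monoSq_smul α r z),
    radialMoment_succ] at h
  have hw : 0 ≤ ∫ φ, monoSq α φ ∂haar D := integral_nonneg fun z => monoSq_nonneg α z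
  have hqw : 0 ≤ ∫ φ, quad lam φ * monoSq α φ ∂haar D :=
    integral_nonneg fun z => mul_nonneg (quad_nonneg hl z) (monoSq_nonneg α z)
  have hsα : ∑ i, lam i * (α i : ℝ) ≤ (∑ l, α l : ℕ) * s := by
    push_cast
    rw [Finset.sum_mul]
    exact Finset.sum_le_sum fun i _ => by
      rw [mul_comm]; exact mul_le_mul_of_nonneg_left (hs i) (Nat.cast_nonneg _)
  have hR := radialMoment_pos (D := D) (∑ l, α l)
  refine le_of_mul_le_mul_left ?_ hR
  calc _ = D * radialMoment D (∑ l, α l) * ∫ φ, quad lam φ * monoSq α φ ∂haar D := by ring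
    _ ≤ (D + (∑ l, α l : ℕ)) * radialMoment D (∑ l, α l)
        * ∫ φ, quad lam φ * monoSq α φ ∂haar D := by
        gcongr
        exact le_add_of_nonneg_right (Nat.cast_nonneg _)
    _ = _ := h
    _ ≤ (1 + (∑ l, α l : ℕ) * s) * (radialMoment D (∑ l, α l) * ∫ φ, monoSq α φ ∂haar D) := by
        gcongr
    _ = _ := by ring

lemma mul_integral_haar_quad {lam : Fin D → ℝ} (hl : ∀ l, 0 ≤ lam l) (hsum : ∑ l, lam l = 1) :
    D * ∫ φ, quad lam φ ∂haar D = 1 := by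
  have h := gaussInt_quad_monoSq 0 hl hsum
  have e : monoSq (0 : Fin D → ℕ) = fun _ => 1 := by funext z; simp
  simp only [monoSq_zero, mul_one, Pi.zero_apply, Nat.cast_zero, mul_zero, Finset.sum_const_zero,
    add_zero, one_mul, e] at h
  rw [gaussInt_eq_radialMoment_mul (F := fun z => quad lam z) (m := 1)
    (fun r z _ => by rw [quad_smul, mul_one]), ← radialMoment_zero, radialMoment_succ] at h
  have hR := radialMoment_zero_pos (D := D)
  simp only [Nat.cast_zero, add_zero] at h
  refine mul_left_cancel₀ hR.ne' ?_
  linarith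

lemma pow_mul_integral_haar_le {lam : Fin D → ℝ} {m : ℕ} {B : ℝ} (hl : ∀ l, 0 ≤ lam l)
    (h : gaussInt (fun z => quad lam z ^ m) ≤
      B * gaussInt (fun _ : EuclideanSpace ℂ (Fin D) => 1)) :
    D ^ m * ∫ φ, quad lam φ ^ m ∂haar D ≤ B := by
  rw [gaussInt_eq_radialMoment_mul (m := m) (F := fun z => quad lam z ^ m)
    (fun r z _ => by rw [quad_smul, mul_pow, ← pow_mul]), ← radialMoment_zero] at h
  have h0 : 0 ≤ ∫ φ, quad lam φ ^ m ∂haar D :=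
    integral_nonneg fun z => pow_nonneg (quad_nonneg hl z) m
  have h1 := mul_le_mul_of_nonneg_right (pow_mul_radialMoment_zero_le (D := D) m) h0
  refine le_of_mul_le_mul_right ?_ (radialMoment_zero_pos (D := D))
  calc _ = D ^ m * radialMoment D 0 * ∫ φ, quad lam φ ^ m ∂haar D := by ring
    _ ≤ _ := h1.trans h

/-- In the law weighted by a monomial of degree `k = n + 1`, the expectation of `X ^ (1 - k)` with
`X = D ⟨φ|σ|φ⟩` is `1 + O(k ^ 2 ‖σ‖_2)`. -/
lemma integral_haar_weighted_bounds {lam : Fin D → ℝ} {α : Fin D → ℕ} (hl : ∀ l, 0 ≤ lam l)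
    (hsum : ∑ l, lam l = 1) {s : ℝ} (hs : ∀ l, lam l ≤ s) (hDs : 1 / (D : ℝ) ≤ s)
    {n : ℕ} (hn : ((n + 1 : ℕ) : ℝ) ^ 2 * s ≤ 1 / 12) (hα : ∑ l, α l = n + 1) :
    (1 - 6 * (((n + 1 : ℕ) : ℝ) ^ 2 * s)) * ∫ φ, monoSq α φ ∂haar D ≤
      ∫ φ, ((D * quad lam φ) ^ n)⁻¹ * monoSq α φ ∂haar D ∧
    ∫ φ, ((D * quad lam φ) ^ n)⁻¹ * monoSq α φ ∂haar D ≤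
      (1 + 6 * (((n + 1 : ℕ) : ℝ) ^ 2 * s)) * ∫ φ, monoSq α φ ∂haar D := by
  have hD := natCast_D_pos (D := D)
  have hs0 : 0 < s := lt_of_lt_of_le (by positivity) hDs
  set k : ℝ := ((n + 1 : ℕ) : ℝ) with hk
  have hnk : (n : ℝ) + 1 = k := by simp [hk]
  have hn0 : (0 : ℝ) ≤ n := Nat.cast_nonneg n
  have hk1 : 1 ≤ k := by linarith
  have hw : 0 ≤ ∫ φ, monoSq α φ ∂haar D := integral_nonneg fun z => monoSq_nonneg α z
  have hns : n * s ≤ 1 / 12 := by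
    refine le_trans ?_ hn
    gcongr
    nlinarith
  obtain ⟨hint, hup⟩ := integral_haar_quad_inv_pow_le hl hsum hs0.le hs (n := n) (by linarith) hα
  constructor
  · -- Bernoulli's inequality `x ^ (-n) ≥ 1 - n (x - 1)` reduces the lower bound to `E X`.
    have hber : ∀ᵐ φ ∂haar D, (1 + n) * monoSq α φ - n * D * (quad lam φ * monoSq α φ) ≤
        ((D * quad lam φ) ^ n)⁻¹ * monoSq α φ := by
      filter_upwards [ae_haar_quad_pos hl hsum] with φ hφ
      have hx : 0 < D * quad lam φ := mul_pos hD hφ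
      have h1 := one_add_mul_le_pow (a := (D * quad lam φ)⁻¹ - 1)
        (by linarith [inv_pos.2 hx]) n
      have h2 : 1 - (D * quad lam φ) ≤ (D * quad lam φ)⁻¹ - 1 := by
        have : 0 ≤ ((D * quad lam φ) - 1) ^ 2 * (D * quad lam φ)⁻¹ := by positivity
        have e : ((D * quad lam φ) - 1) ^ 2 * (D * quad lam φ)⁻¹ =
            D * quad lam φ - 2 + (D * quad lam φ)⁻¹ := by
          field_simp
          ring
        linarith
      have h3 : (1 + n) - n * (D * quad lam φ) ≤ ((D * quad lam φ) ^ n)⁻¹ := by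
        rw [← inv_pow]
        have := mul_le_mul_of_nonneg_left h2 hn0
        have e : 1 + ((D * quad lam φ)⁻¹ - 1) = (D * quad lam φ)⁻¹ := by ring
        rw [e] at h1
        linarith
      have := mul_le_mul_of_nonneg_right h3 (monoSq_nonneg α φ)
      linarith
    have hi1 := (integrable_haar_monoSq α).const_mul (1 + (n : ℝ))
    have hi2 := (integrable_haar_quad_mul_monoSq lam α).const_mul (n * (D : ℝ))
    have hi3 : Integrable (fun φ => ((D * quad lam φ) ^ n)⁻¹ * monoSq α φ) (haar D) := by
      simpa only [mul_pow, mul_inv, mul_assoc] using hint.const_mul (((D : ℝ) ^ n)⁻¹)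
    have hle := integral_mono_ae (hi1.sub hi2) hi3 hber
    simp only [Pi.sub_apply] at hle
    rw [integral_sub hi1 hi2, integral_const_mul, integral_const_mul] at hle
    have hq := mul_integral_haar_quad_mul_le α hl hsum hs
    rw [hα, ← hk] at hq
    have hq' := mul_le_mul_of_nonneg_left hq hn0
    have h5 : n * (k * s) ≤ 6 * (k ^ 2 * s) := by
      have : 0 ≤ k * s := by positivity
      nlinarith
    have h6 := mul_le_mul_of_nonneg_right h5 hw
    nlinarith
  · have e : (fun φ => ((D * quad lam φ) ^ n)⁻¹ * monoSq α φ) =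
        fun φ => ((D : ℝ) ^ n)⁻¹ * ((quad lam φ ^ n)⁻¹ * monoSq α φ) := by
      funext φ
      rw [mul_pow, mul_inv, mul_assoc]
    rw [e, integral_const_mul]
    have h1 : ((D : ℝ) ^ n)⁻¹ * (((1 - n * s) ^ n)⁻¹ * (D + k) ^ n) ≤ 1 + 6 * (k ^ 2 * s) := by
      have h2 : (1 - n * s)⁻¹ ≤ Real.exp (2 * (n * s)) := by
        have h3 : (1 - n * s)⁻¹ ≤ 1 + 2 * (n * s) := by
          rw [inv_le_iff_one_le_mul₀ (by linarith)]
          have : 0 ≤ n * s := by positivity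
          nlinarith
        linarith [Real.add_one_le_exp (2 * (n * s))]
      have h4 : (D : ℝ)⁻¹ * (D + k) ≤ Real.exp (k * s) := by
        have h5 : (D : ℝ)⁻¹ * (D + k) = 1 + k * (1 / D) := by field_simp
        have h6 : k * (1 / D) ≤ k * s := by gcongr
        linarith [Real.add_one_le_exp (k * s)]
      calc ((D : ℝ) ^ n)⁻¹ * (((1 - n * s) ^ n)⁻¹ * (D + k) ^ n)
          = ((1 - n * s)⁻¹ * ((D : ℝ)⁻¹ * (D + k))) ^ n := by
            rw [mul_pow, mul_pow, inv_pow, inv_pow]; ring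
        _ ≤ (Real.exp (2 * (n * s)) * Real.exp (k * s)) ^ n := by
            have : 0 ≤ (1 - n * s)⁻¹ := inv_nonneg.2 (by linarith)
            gcongr
        _ = Real.exp (n * (2 * (n * s) + k * s)) := by
            rw [← Real.exp_add, ← Real.exp_nat_mul]
        _ ≤ Real.exp (3 * (k ^ 2 * s)) := by
            refine Real.exp_le_exp.2 ?_
            have h7 : (n : ℝ) ≤ k := by linarith
            calc n * (2 * (n * s) + k * s) ≤ k * (2 * (k * s) + k * s) := by gcongr
              _ = _ := by ring
        _ ≤ 1 + 6 * (k ^ 2 * s) := by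
            have h8 : 0 ≤ 3 * (k ^ 2 * s) := by positivity
            have := Real.abs_exp_sub_one_le (x := 3 * (k ^ 2 * s))
              (by rw [abs_of_nonneg h8]; linarith)
            rw [abs_of_nonneg h8] at this
            linarith [le_abs_self (Real.exp (3 * (k ^ 2 * s)) - 1)]
    calc _ ≤ ((D : ℝ) ^ n)⁻¹ * (((1 - n * s) ^ n)⁻¹ * (D + k) ^ n *
          ∫ φ, monoSq α φ ∂haar D) := by gcongr
      _ = ((D : ℝ) ^ n)⁻¹ * (((1 - n * s) ^ n)⁻¹ * (D + k) ^ n) *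
          ∫ φ, monoSq α φ ∂haar D := by ring
      _ ≤ _ := by gcongr

/-- The mean deviation `E |X - X ^ k|` for `X = D ⟨φ|σ|φ⟩` and `k = n + 1`: the variance of `X` is
at most `‖σ‖_2 ^ 2`, and its moments of order up to `2 n` are bounded by a constant. -/
lemma integral_haar_abs_sub_pow_le {lam : Fin D → ℝ} (hl : ∀ l, 0 ≤ lam l)
    (hsum : ∑ l, lam l = 1) {s : ℝ} (hs : ∀ l, lam l ≤ s) (hs0 : 0 < s)
    (hs2 : ∑ l, lam l ^ 2 = s ^ 2) {n : ℕ} (hn : ((n + 1 : ℕ) : ℝ) ^ 2 * s ≤ 1 / 12) :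
    ∫ φ, |D * quad lam φ - (D * quad lam φ) ^ (n + 1)| ∂haar D ≤ 2 * (n * s) := by
  have hD := natCast_D_pos (D := D)
  set X : EuclideanSpace ℂ (Fin D) → ℝ := fun φ => D * quad lam φ with hX
  have hX0 : ∀ φ, 0 ≤ X φ := fun φ => mul_nonneg hD.le (quad_nonneg hl φ)
  have hXi : ∀ m, Integrable (fun φ => X φ ^ m) (haar D) := fun m => by
    simpa only [hX, mul_pow] using (integrable_haar_quad_pow lam m).const_mul _
  have hX1i : Integrable X (haar D) := by simpa using hXi 1
  have hXp : ∀ m B, gaussInt (fun z => quad lam z ^ m) ≤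
      B * gaussInt (fun _ : EuclideanSpace ℂ (Fin D) => 1) → ∫ φ, X φ ^ m ∂haar D ≤ B := by
    intro m B h
    simp only [hX, mul_pow]
    rw [integral_const_mul]
    exact pow_mul_integral_haar_le hl h
  have hX1 : ∫ φ, X φ ∂haar D = 1 := by
    simp only [hX]
    rw [integral_const_mul]
    exact mul_integral_haar_quad hl hsum
  have hvari : Integrable (fun φ => (X φ - 1) ^ 2) (haar D) := by
    have := ((hXi 2).sub (hX1i.const_mul 2)).add (integrable_const (1 : ℝ))
    refine this.congr (ae_of_all _ fun φ => ?_)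
    simp only [Pi.add_apply, Pi.sub_apply]
    ring
  have hvar : ∫ φ, (X φ - 1) ^ 2 ∂haar D ≤ s ^ 2 := by
    have e : (fun φ => (X φ - 1) ^ 2) = fun φ => X φ ^ 2 - 2 * X φ + 1 := by
      funext φ; ring
    have h2 := hXp 2 (1 + s ^ 2) (by rw [gaussInt_quad_sq hl hsum, hs2])
    rw [e, integral_add (f := fun φ => X φ ^ 2 - 2 * X φ) (g := fun _ => 1)
      ((hXi 2).sub (hX1i.const_mul 2)) (integrable_const _),
      integral_sub (hXi 2) (hX1i.const_mul 2), integral_const_mul, hX1]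
    simp
    linarith
  have hmom : ∀ j < n, ∫ φ, X φ ^ (2 * (j + 1)) ∂haar D ≤ 2 := by
    intro j hj
    refine hXp _ _ ((gaussInt_quad_pow_le hl hsum hs0.le hs _).trans ?_)
    refine mul_le_mul_of_nonneg_right ?_ (gaussInt_nonneg fun _ => zero_le_one)
    set m : ℝ := ((2 * (j + 1) : ℕ) : ℝ) with hm
    have hm2 : m ≤ 2 * ((n + 1 : ℕ) : ℝ) := by
      rw [hm]; exact_mod_cast by omega
    have hm0 : 0 ≤ m := Nat.cast_nonneg _
    have h8 : 0 ≤ m * (m * s) := by positivity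
    have h9 : m * (m * s) ≤ 1 / 3 := by
      calc m * (m * s) ≤ (2 * ((n + 1 : ℕ) : ℝ)) * ((2 * ((n + 1 : ℕ) : ℝ)) * s) := by gcongr
        _ = 4 * (((n + 1 : ℕ) : ℝ) ^ 2 * s) := by ring
        _ ≤ _ := by linarith
    calc (1 + m * s) ^ (2 * (j + 1)) ≤ Real.exp (m * s) ^ (2 * (j + 1)) := by
          gcongr
          linarith [Real.add_one_le_exp (m * s)]
      _ = Real.exp (m * (m * s)) := by rw [← Real.exp_nat_mul]
      _ ≤ 2 := by
          have := Real.abs_exp_sub_one_le (x := m * (m * s))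
            (by rw [abs_of_nonneg h8]; linarith)
          rw [abs_of_nonneg h8] at this
          linarith [le_abs_self (Real.exp (m * (m * s)) - 1)]
  have hpt : ∀ φ, |X φ - X φ ^ (n + 1)| ≤
      ∑ j ∈ Finset.range n, (1 / (2 * s) * (X φ - 1) ^ 2 + s / 2 * X φ ^ (2 * (j + 1))) := by
    intro φ
    have hgeom : X φ - X φ ^ (n + 1) = ∑ j ∈ Finset.range n, -((X φ - 1) * X φ ^ (j + 1)) := by
      have := geom_sum_mul (X φ) n
      simp only [pow_succ, ← mul_assoc, Finset.sum_neg_distrib]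
      rw [← Finset.sum_mul, ← Finset.mul_sum, mul_comm (X φ - 1), this]
      ring
    rw [hgeom]
    refine (Finset.abs_sum_le_sum_abs _ _).trans (Finset.sum_le_sum fun j _ => ?_)
    rw [abs_neg, abs_mul, pow_mul', ← sq_abs (X φ - 1), ← sq_abs (X φ ^ (j + 1))]
    -- The arithmetic-geometric mean inequality, with `s` balancing the two factors.
    have : 0 ≤ 1 / (2 * s) * (|X φ - 1| - s * |X φ ^ (j + 1)|) ^ 2 := by positivity
    have e : 1 / (2 * s) * (|X φ - 1| - s * |X φ ^ (j + 1)|) ^ 2 =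
        1 / (2 * s) * |X φ - 1| ^ 2 + s / 2 * |X φ ^ (j + 1)| ^ 2
          - |X φ - 1| * |X φ ^ (j + 1)| := by
      field_simp
      ring
    linarith
  have hsi : ∀ j, Integrable (fun φ => 1 / (2 * s) * (X φ - 1) ^ 2
      + s / 2 * X φ ^ (2 * (j + 1))) (haar D) := fun j =>
    (hvari.const_mul _).add ((hXi _).const_mul _)
  calc ∫ φ, |X φ - X φ ^ (n + 1)| ∂haar D
      ≤ ∫ φ, ∑ j ∈ Finset.range n, (1 / (2 * s) * (X φ - 1) ^ 2
          + s / 2 * X φ ^ (2 * (j + 1))) ∂haar D :=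
        integral_mono (hX1i.sub (hXi _)).abs (integrable_finsetSum _ fun j _ => hsi j) hpt
    _ = ∑ j ∈ Finset.range n, (1 / (2 * s) * ∫ φ, (X φ - 1) ^ 2 ∂haar D
          + s / 2 * ∫ φ, X φ ^ (2 * (j + 1)) ∂haar D) := by
        rw [integral_finsetSum _ fun j _ => hsi j]
        refine Finset.sum_congr rfl fun j _ => ?_
        rw [integral_add (hvari.const_mul _) ((hXi _).const_mul _), integral_const_mul,
          integral_const_mul]
    _ ≤ ∑ j ∈ Finset.range n, (1 / (2 * s) * s ^ 2 + s / 2 * 2) := by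
        refine Finset.sum_le_sum fun j hj => ?_
        have := hmom j (Finset.mem_range.1 hj)
        gcongr
    _ = 3 / 2 * (n * s) := by
        rw [Finset.sum_const, Finset.card_range, nsmul_eq_mul]
        field_simp
        ring
    _ ≤ _ := by
        have : 0 ≤ n * s := by positivity
        linarith

end

/-! ### Orthogonality of monomials on the sphere -/

section

variable {D k : ℕ}

/-- The product vector `φ^{⊗k}` in the product basis. -/
def tensorVec (k : ℕ) (φ : EuclideanSpace ℂ (Fin D)) : (Fin k → Fin D) → ℂ :=
  fun i => ∏ a, φ (i a)

/-- The occupation numbers of a basis vector of `(ℂ ^ D)^{⊗k}`: the number of tensor factors in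
each of the `D` levels. -/
def occupation (i : Fin k → Fin D) : Fin D → ℕ :=
  fun l => (Finset.univ.filter fun a => i a = l).card

lemma sum_occupation (i : Fin k → Fin D) : ∑ l, occupation i l = k := by
  simpa [occupation] using (Finset.card_eq_sum_card_fiberwise (f := i) (s := Finset.univ)
    (t := Finset.univ) (fun _ _ => Finset.mem_coe.2 (Finset.mem_univ _))).symm

lemma prod_apply_eq_prod_pow {M : Type*} [CommMonoid M] (f : Fin D → M) (i : Fin k → Fin D) :
    ∏ a, f (i a) = ∏ l, f l ^ occupation i l := by
  rw [← Finset.prod_fiberwise Finset.univ i]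
  refine Finset.prod_congr rfl fun l _ => ?_
  rw [occupation, ← Finset.prod_const]
  exact Finset.prod_congr rfl fun a ha => by rw [(Finset.mem_filter.1 ha).2]

lemma tensorPow_ketbra (k : ℕ) (φ : EuclideanSpace ℂ (Fin D)) (i j : Fin k → Fin D) :
    tensorPow k (ketbra φ) i j = tensorVec k φ i * star (tensorVec k φ j) := by
  simp [tensorPow, ketbra, tensorVec, Finset.prod_mul_distrib]

lemma continuous_tensorVec (i : Fin k → Fin D) :
    Continuous fun φ : EuclideanSpace ℂ (Fin D) => tensorVec k φ i := by
  unfold tensorVec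
  fun_prop

lemma normSq_tensorVec (φ : EuclideanSpace ℂ (Fin D)) (i : Fin k → Fin D) :
    ‖tensorVec k φ i‖ ^ 2 = monoSq (occupation i) φ := by
  rw [tensorVec, norm_prod, ← Finset.prod_pow, monoSq,
    prod_apply_eq_prod_pow (fun l => ‖φ l‖ ^ 2) i]

lemma tensorVec_mul_star_of_occupation_eq (φ : EuclideanSpace ℂ (Fin D)) {i j : Fin k → Fin D}
    (h : occupation i = occupation j) :
    tensorVec k φ i * star (tensorVec k φ j) = (monoSq (occupation i) φ : ℂ) := by
  have : tensorVec k φ i = tensorVec k φ j := by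
    simp only [tensorVec]
    rw [prod_apply_eq_prod_pow (fun l => φ l) i, prod_apply_eq_prod_pow (fun l => φ l) j, h]
  rw [← this, ← normSq_tensorVec, ← starRingEnd_apply, Complex.mul_conj']
  push_cast
  rfl

lemma norm_tensorVec_mul_star_le (φ : EuclideanSpace ℂ (Fin D)) (i j : Fin k → Fin D) :
    ‖tensorVec k φ i * star (tensorVec k φ j)‖ ≤
      monoSq (occupation i) φ + monoSq (occupation j) φ := by
  rw [norm_mul, norm_star, ← normSq_tensorVec, ← normSq_tensorVec]
  nlinarith [sq_nonneg (‖tensorVec k φ i‖ - ‖tensorVec k φ j‖), sq_nonneg ‖tensorVec k φ i‖,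
    sq_nonneg ‖tensorVec k φ j‖]

/-- A unitary matrix as a real-linear isometry. -/
def unitaryIsometry (U : Matrix.unitaryGroup (Fin D) ℂ) :
    EuclideanSpace ℂ (Fin D) ≃ₗᵢ[ℝ] EuclideanSpace ℂ (Fin D) :=
  let e := Unitary.linearIsometryEquiv (𝕜 := ℂ) (H := EuclideanSpace ℂ (Fin D))
    ⟨Matrix.toEuclideanCLM (n := Fin D) (𝕜 := ℂ) U.1, Unitary.map_mem _ U.2⟩
  { toLinearEquiv := e.toLinearEquiv.restrictScalars ℝ
    norm_map' := e.norm_map }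

lemma integral_haar_act_unitary {F : Type*} [NormedAddCommGroup F] [NormedSpace ℝ F]
    (U : Matrix.unitaryGroup (Fin D) ℂ) (f : EuclideanSpace ℂ (Fin D) → F) :
    ∫ φ, f (act U.1 φ) ∂haar D = ∫ φ, f φ ∂haar D := by
  conv_rhs => rw [← map_isometry_haar (unitaryIsometry U)]
  exact ((unitaryIsometry U).toHomeomorph.measurableEmbedding.integral_map f).symm

/-- The diagonal unitary that multiplies the `l`-th coordinate by the phase `exp (i θ)`. -/
def phaseUnitary (l : Fin D) (θ : ℝ) : Matrix.unitaryGroup (Fin D) ℂ :=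
  ⟨Matrix.diagonal fun m => if m = l then Complex.exp (θ * Complex.I) else 1, by
    rw [Matrix.mem_unitaryGroup_iff, Matrix.star_eq_conjTranspose, Matrix.diagonal_conjTranspose,
      Matrix.diagonal_mul_diagonal, ← Matrix.diagonal_one]
    congr 1
    funext m
    by_cases h : m = l
    · simp [h, Complex.mul_conj', Complex.norm_exp_ofReal_mul_I]
    · simp [h]⟩

lemma act_phaseUnitary_apply (l : Fin D) (θ : ℝ) (φ : EuclideanSpace ℂ (Fin D)) (m : Fin D) :
    act (phaseUnitary l θ).1 φ m = (if m = l then Complex.exp (θ * Complex.I) else 1) * φ m := by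
  simp [act, phaseUnitary, Matrix.mulVec_diagonal]

lemma norm_act_phaseUnitary_apply (l : Fin D) (θ : ℝ) (φ : EuclideanSpace ℂ (Fin D)) (m : Fin D) :
    ‖act (phaseUnitary l θ).1 φ m‖ = ‖φ m‖ := by
  rw [act_phaseUnitary_apply, norm_mul]
  by_cases h : m = l
  · simp [h, Complex.norm_exp_ofReal_mul_I]
  · simp [h]

lemma tensorVec_act_phaseUnitary (l : Fin D) (θ : ℝ) (φ : EuclideanSpace ℂ (Fin D))
    (i : Fin k → Fin D) : tensorVec k (act (phaseUnitary l θ).1 φ) i =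
      Complex.exp (θ * Complex.I) ^ occupation i l * tensorVec k φ i := by
  simp only [tensorVec, act_phaseUnitary_apply, Finset.prod_mul_distrib]
  congr 1
  rw [Finset.prod_ite]
  simp [occupation]

/-- Monomials with different exponent vectors are orthogonal for every weight that is a function of
the moduli of the coordinates. -/
lemma integral_haar_tensorVec_of_occupation_ne {h : EuclideanSpace ℂ (Fin D) → ℝ}
    (hh : ∀ φ ψ, (∀ l, ‖φ l‖ = ‖ψ l‖) → h φ = h ψ) {i j : Fin k → Fin D}
    (hij : occupation i ≠ occupation j) :
    ∫ φ, (h φ : ℂ) * (tensorVec k φ i * star (tensorVec k φ j)) ∂haar D = 0 := by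
  obtain ⟨l, hl⟩ := Function.ne_iff.1 hij
  -- With this angle the two monomials pick up the relative phase `exp (i π) = -1`.
  set d : ℝ := (occupation i l : ℝ) - occupation j l with hd
  have hd0 : d ≠ 0 := sub_ne_zero.2 (by exact_mod_cast hl)
  set θ : ℝ := Real.pi / d with hθ
  have hphase : Complex.exp (θ * Complex.I) ^ occupation i l *
      star (Complex.exp (θ * Complex.I) ^ occupation j l) = -1 := by
    rw [star_pow, ← starRingEnd_apply, ← Complex.exp_conj, map_mul, Complex.conj_I,
      Complex.conj_ofReal, ← Complex.exp_nat_mul, ← Complex.exp_nat_mul, ← Complex.exp_add,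
      ← Complex.exp_pi_mul_I]
    congr 1
    have h1 : (θ : ℂ) * (occupation i l - occupation j l : ℂ) = Real.pi := by
      have : θ * d = Real.pi := by rw [hθ]; field_simp
      rw [hd] at this
      exact_mod_cast this
    linear_combination Complex.I * h1
  have hI := integral_haar_act_unitary (phaseUnitary l θ) fun φ : EuclideanSpace ℂ (Fin D) =>
    (h φ : ℂ) * (tensorVec k φ i * star (tensorVec k φ j))
  have e : ∀ φ : EuclideanSpace ℂ (Fin D), (h (act (phaseUnitary l θ).1 φ) : ℂ) *
      (tensorVec k (act (phaseUnitary l θ).1 φ) i *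
        star (tensorVec k (act (phaseUnitary l θ).1 φ) j)) =
      -((h φ : ℂ) * (tensorVec k φ i * star (tensorVec k φ j))) := by
    intro φ
    rw [hh _ φ (norm_act_phaseUnitary_apply l θ φ), tensorVec_act_phaseUnitary,
      tensorVec_act_phaseUnitary, star_mul']
    linear_combination (h φ : ℂ) * tensorVec k φ i * star (tensorVec k φ j) * hphase
  simp only [e, integral_neg] at hI
  exact self_eq_neg.1 hI.symm

/-- The homogeneous polynomial `⟨v|φ^{⊗k}⟩`. -/
def tensorPoly (v : (Fin k → Fin D) → ℂ) (φ : EuclideanSpace ℂ (Fin D)) : ℂ :=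
  star v ⬝ᵥ tensorVec k φ

lemma normSq_tensorPoly (v : (Fin k → Fin D) → ℂ) (φ : EuclideanSpace ℂ (Fin D)) :
    ((‖tensorPoly v φ‖ ^ 2 : ℝ) : ℂ) =
      ∑ i, ∑ j, star (v i) * v j * (tensorVec k φ i * star (tensorVec k φ j)) := by
  push_cast
  rw [← Complex.mul_conj', tensorPoly, dotProduct, map_sum, Finset.sum_mul_sum]
  refine Finset.sum_congr rfl fun i _ => Finset.sum_congr rfl fun j _ => ?_
  simp
  ring

lemma integrable_weight_mul_tensorVec {h : EuclideanSpace ℂ (Fin D) → ℝ} (hm : Measurable h)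
    (hint : ∀ α : Fin D → ℕ, ∑ l, α l = k → Integrable (fun φ => h φ * monoSq α φ) (haar D))
    (i j : Fin k → Fin D) :
    Integrable (fun φ => (h φ : ℂ) * (tensorVec k φ i * star (tensorVec k φ j))) (haar D) := by
  have hi := ((hint _ (sum_occupation i)).norm.add (hint _ (sum_occupation j)).norm)
  refine hi.mono' ?_ (ae_of_all _ fun φ => ?_)
  · have h1 := (continuous_tensorVec (D := D) i).measurable
    have h2 := (continuous_tensorVec (D := D) j).star.measurable
    exact ((Complex.measurable_ofReal.comp hm).mul (h1.mul h2)).aestronglyMeasurable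
  · rw [norm_mul, Complex.norm_real]
    simp only [Pi.add_apply, norm_mul (h φ), Real.norm_of_nonneg (monoSq_nonneg _ φ), ← mul_add]
    exact mul_le_mul_of_nonneg_left (norm_tensorVec_mul_star_le φ i j) (norm_nonneg _)

/-- For weights that depend on the moduli of the coordinates only, positivity on all homogeneous
polynomials can be tested on monomials. -/
lemma integral_haar_normSq_tensorPoly_nonneg {h : EuclideanSpace ℂ (Fin D) → ℝ}
    (hm : Measurable h) (hh : ∀ φ ψ, (∀ l, ‖φ l‖ = ‖ψ l‖) → h φ = h ψ)
    (hint : ∀ α : Fin D → ℕ, ∑ l, α l = k → Integrable (fun φ => h φ * monoSq α φ) (haar D))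
    (hpos : ∀ α : Fin D → ℕ, ∑ l, α l = k → 0 ≤ ∫ φ, h φ * monoSq α φ ∂haar D)
    (v : (Fin k → Fin D) → ℂ) : 0 ≤ ∫ φ, h φ * ‖tensorPoly v φ‖ ^ 2 ∂haar D := by
  set m : (Fin D → ℕ) → ℝ := fun α => ∫ φ, h φ * monoSq α φ ∂haar D with hmdef
  have hT := integrable_weight_mul_tensorVec hm hint
  have hent : ∀ i j : Fin k → Fin D,
      ∫ φ, (h φ : ℂ) * (tensorVec k φ i * star (tensorVec k φ j)) ∂haar D =
        if occupation i = occupation j then (m (occupation i) : ℂ) else 0 := by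
    intro i j
    split_ifs with hij
    · rw [hmdef, ← integral_complex_ofReal]
      refine integral_congr_ae (ae_of_all _ fun φ => ?_)
      simp only [tensorVec_mul_star_of_occupation_eq φ hij]
      push_cast
      rfl
    · exact integral_haar_tensorVec_of_occupation_ne hh hij
  have hsum : ((∫ φ, h φ * ‖tensorPoly v φ‖ ^ 2 ∂haar D : ℝ) : ℂ) =
      ∑ i, ∑ j, star (v i) * v j *
        if occupation i = occupation j then (m (occupation i) : ℂ) else 0 := by
    rw [← integral_complex_ofReal]
    have e : ∀ φ, ((h φ * ‖tensorPoly v φ‖ ^ 2 : ℝ) : ℂ) = ∑ i, ∑ j, star (v i) * v j *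
        ((h φ : ℂ) * (tensorVec k φ i * star (tensorVec k φ j))) := by
      intro φ
      rw [Complex.ofReal_mul, normSq_tensorPoly, Finset.mul_sum]
      refine Finset.sum_congr rfl fun i _ => ?_
      rw [Finset.mul_sum]
      exact Finset.sum_congr rfl fun j _ => by ring
    simp only [e]
    rw [integral_finsetSum _ fun i _ => integrable_finsetSum _ fun j _ => (hT i j).const_mul _]
    refine Finset.sum_congr rfl fun i _ => ?_
    rw [integral_finsetSum _ fun j _ => (hT i j).const_mul _]
    exact Finset.sum_congr rfl fun j _ => by rw [integral_const_mul, hent]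
  -- Grouping basis vectors by occupation numbers turns the double sum into a sum of squares.
  set T : Finset (Fin D → ℕ) := Finset.univ.image (occupation (D := D) (k := k)) with hTdef
  have hgroup : (∑ i, ∑ j, star (v i) * v j *
        if occupation i = occupation j then (m (occupation i) : ℂ) else 0) =
      ((∑ t ∈ T, m t * ‖∑ i with occupation i = t, v i‖ ^ 2 : ℝ) : ℂ) := by
    rw [← Finset.sum_fiberwise_of_maps_to (s := Finset.univ) (t := T) (g := occupation)
      (fun i _ => Finset.mem_image_of_mem _ (Finset.mem_univ i))]
    push_cast
    refine Finset.sum_congr rfl fun t _ => ?_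
    rw [← Complex.conj_mul', map_sum, Finset.sum_mul_sum, Finset.mul_sum]
    refine Finset.sum_congr rfl fun i hi => ?_
    have hit : occupation i = t := (Finset.mem_filter.1 hi).2
    rw [Finset.mul_sum, Finset.sum_filter]
    refine Finset.sum_congr rfl fun j _ => ?_
    by_cases hj : occupation j = t
    · simp [hit, hj]
      ring
    · simp [hit, hj, Ne.symm hj]
  rw [hgroup] at hsum
  rw [Complex.ofReal_injective hsum]
  refine Finset.sum_nonneg fun t ht => mul_nonneg ?_ (by positivity)
  obtain ⟨i, -, rfl⟩ := Finset.mem_image.1 ht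
  exact hpos _ (sum_occupation i)

end

/-! ### Weighted moments, trace norm and spectral decomposition -/

section

variable {D k : ℕ}

lemma act_apply (A : Matrix (Fin D) (Fin D) ℂ) (φ : EuclideanSpace ℂ (Fin D)) (i : Fin D) :
    act A φ i = ∑ j, A i j * φ j := rfl

lemma act_act (A B : Matrix (Fin D) (Fin D) ℂ) (φ : EuclideanSpace ℂ (Fin D)) :
    act A (act B φ) = act (A * B) φ := by
  simp [act, Matrix.mulVec_mulVec]

lemma continuous_act (A : Matrix (Fin D) (Fin D) ℂ) : Continuous (act A) :=
  (Matrix.toEuclideanCLM (n := Fin D) (𝕜 := ℂ) A).continuous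

lemma norm_act_le (A : Matrix (Fin D) (Fin D) ℂ) (φ : EuclideanSpace ℂ (Fin D)) :
    ‖act A φ‖ ≤ ‖Matrix.toEuclideanCLM (n := Fin D) (𝕜 := ℂ) A‖ * ‖φ‖ :=
  (Matrix.toEuclideanCLM (n := Fin D) (𝕜 := ℂ) A).le_opNorm φ

lemma inner_act (A : Matrix (Fin D) (Fin D) ℂ) (φ ψ : EuclideanSpace ℂ (Fin D)) :
    inner ℂ (act A φ) ψ = inner ℂ φ (act A.conjTranspose ψ) := by
  simp only [EuclideanSpace.inner_eq_star_dotProduct, act, Matrix.star_mulVec]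
  rw [dotProduct_comm, ← Matrix.dotProduct_mulVec, dotProduct_comm]

lemma normSq_act (A : Matrix (Fin D) (Fin D) ℂ) (φ : EuclideanSpace ℂ (Fin D)) :
    ‖act A φ‖ ^ 2 = expVal (A.conjTranspose * A) φ := by
  rw [expVal, ← act_act, ← inner_act, inner_self_eq_norm_sq_to_K]
  norm_cast

lemma expVal_diagonal (lam : Fin D → ℝ) (φ : EuclideanSpace ℂ (Fin D)) :
    expVal (Matrix.diagonal fun l => (lam l : ℂ)) φ = quad lam φ := by
  simp only [expVal, act, PiLp.inner_apply, Matrix.mulVec_diagonal, Complex.re_sum, quad]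
  refine Finset.sum_congr rfl fun l _ => ?_
  have : inner ℂ (φ l) ((lam l : ℂ) * φ l) = ((lam l * ‖φ l‖ ^ 2 : ℝ) : ℂ) := by
    rw [RCLike.inner_apply, mul_assoc, Complex.mul_conj']
    push_cast
    rfl
  rw [this, Complex.ofReal_re]

lemma expVal_smul (c : ℝ) (σ : Matrix (Fin D) (Fin D) ℂ) (φ : EuclideanSpace ℂ (Fin D)) :
    expVal ((c : ℂ) • σ) φ = c * expVal σ φ := by
  have : act ((c : ℂ) • σ) φ = (c : ℂ) • act σ φ := by
    simp [act, Matrix.smul_mulVec]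
  rw [expVal, this, inner_smul_right, Complex.re_ofReal_mul, expVal]

lemma expVal_act (U σ : Matrix (Fin D) (Fin D) ℂ) (φ : EuclideanSpace ℂ (Fin D)) :
    expVal σ (act U φ) = expVal (U.conjTranspose * σ * U) φ := by
  rw [expVal, expVal, inner_act, act_act, act_act, mul_assoc]

lemma tensorVec_act (A : Matrix (Fin D) (Fin D) ℂ) (φ : EuclideanSpace ℂ (Fin D)) :
    tensorVec k (act A φ) = (tensorPow k A).mulVec (tensorVec k φ) := by
  funext i
  simp only [tensorVec, act_apply, Matrix.mulVec, dotProduct, tensorPow, Matrix.of_apply,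
    ← Finset.prod_mul_distrib]
  rw [Finset.prod_univ_sum, Fintype.piFinset_univ]

lemma tensorPow_mul (A B : Matrix (Fin D) (Fin D) ℂ) :
    tensorPow k (A * B) = tensorPow k A * tensorPow k B := by
  ext i j
  simp only [tensorPow, Matrix.mul_apply, Matrix.of_apply, ← Finset.prod_mul_distrib]
  rw [Finset.prod_univ_sum, Fintype.piFinset_univ]

lemma tensorPow_conjTranspose (A : Matrix (Fin D) (Fin D) ℂ) :
    tensorPow k A.conjTranspose = (tensorPow k A).conjTranspose := by
  ext i j
  simp [tensorPow]

lemma tensorPow_diagonal (d : Fin D → ℂ) :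
    tensorPow k (Matrix.diagonal d) = Matrix.diagonal fun i : Fin k → Fin D => ∏ a, d (i a) := by
  ext i j
  by_cases h : i = j
  · subst h; simp [tensorPow]
  · obtain ⟨a, ha⟩ := Function.ne_iff.1 h
    rw [Matrix.diagonal_apply_ne _ h, tensorPow, Matrix.of_apply]
    exact Finset.prod_eq_zero (Finset.mem_univ a) (Matrix.diagonal_apply_ne _ ha)

lemma tensorPow_one : tensorPow k (1 : Matrix (Fin D) (Fin D) ℂ) = 1 := by
  rw [← Matrix.diagonal_one, tensorPow_diagonal]
  simp

lemma tensorPoly_act (A : Matrix (Fin D) (Fin D) ℂ) (v : (Fin k → Fin D) → ℂ)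
    (φ : EuclideanSpace ℂ (Fin D)) :
    tensorPoly v (act A φ) = tensorPoly ((tensorPow k A).conjTranspose.mulVec v) φ := by
  rw [tensorPoly, tensorPoly, tensorVec_act, Matrix.star_mulVec, Matrix.conjTranspose_conjTranspose,
    Matrix.dotProduct_mulVec]

lemma tensorVec_smul (c : ℂ) (φ : EuclideanSpace ℂ (Fin D)) (i : Fin k → Fin D) :
    tensorVec k (c • φ) i = c ^ k * tensorVec k φ i := by
  simp [tensorVec, Finset.prod_mul_distrib]

lemma norm_tensorVec_le (φ : EuclideanSpace ℂ (Fin D)) (i : Fin k → Fin D) :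
    ‖tensorVec k φ i‖ ≤ ‖φ‖ ^ k := by
  rw [tensorVec, norm_prod]
  calc _ ≤ ∏ _a : Fin k, ‖φ‖ :=
        Finset.prod_le_prod (fun _ _ => norm_nonneg _) fun a _ => PiLp.norm_apply_le φ (i a)
    _ = _ := by simp

lemma sum_normSq_tensorVec (φ : EuclideanSpace ℂ (Fin D)) :
    ∑ i, ‖tensorVec k φ i‖ ^ 2 = (‖φ‖ ^ 2) ^ k := by
  simp only [tensorVec, norm_prod, ← Finset.prod_pow]
  rw [← Fintype.piFinset_univ,
    ← Finset.prod_univ_sum (fun _ : Fin k => (Finset.univ : Finset (Fin D)))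
    (fun _ l => ‖φ l‖ ^ 2), EuclideanSpace.norm_sq_eq]
  simp

/-- The moment matrix of the vectors `A φ`, with `φ` Haar-distributed and weighted by `h φ`. -/
def weightedMoment (k : ℕ) (A : Matrix (Fin D) (Fin D) ℂ) (h : EuclideanSpace ℂ (Fin D) → ℝ) :
    Matrix (Fin k → Fin D) (Fin k → Fin D) ℂ :=
  Matrix.of fun i j => ∫ φ, (h φ : ℂ) *
    (tensorVec k (act A φ) i * star (tensorVec k (act A φ) j)) ∂haar D

/-- The entries of the weighted moment are given by convergent integrals. -/
def IsMomentWeight (k : ℕ) (A : Matrix (Fin D) (Fin D) ℂ) (h : EuclideanSpace ℂ (Fin D) → ℝ) :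
    Prop :=
  ∀ i j : Fin k → Fin D, Integrable (fun φ => (h φ : ℂ) *
    (tensorVec k (act A φ) i * star (tensorVec k (act A φ) j))) (haar D)

lemma IsMomentWeight.add {A : Matrix (Fin D) (Fin D) ℂ} {h h' : EuclideanSpace ℂ (Fin D) → ℝ}
    (hh : IsMomentWeight k A h) (hh' : IsMomentWeight k A h') :
    IsMomentWeight k A (fun φ => h φ + h' φ) := fun i j => by
  simp only [Complex.ofReal_add, add_mul]
  exact (hh i j).add (hh' i j)

lemma IsMomentWeight.const_mul {A : Matrix (Fin D) (Fin D) ℂ} {h : EuclideanSpace ℂ (Fin D) → ℝ}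
    (hh : IsMomentWeight k A h) (c : ℝ) : IsMomentWeight k A (fun φ => c * h φ) := fun i j => by
  simpa [mul_assoc] using (hh i j).const_mul (c : ℂ)

lemma weightedMoment_add {A : Matrix (Fin D) (Fin D) ℂ} {h h' : EuclideanSpace ℂ (Fin D) → ℝ}
    (hh : IsMomentWeight k A h) (hh' : IsMomentWeight k A h') :
    weightedMoment k A (fun φ => h φ + h' φ) = weightedMoment k A h + weightedMoment k A h' := by
  ext i j
  simp only [weightedMoment, Matrix.of_apply, Matrix.add_apply, Complex.ofReal_add, add_mul]
  exact integral_add (hh i j) (hh' i j)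

lemma weightedMoment_const_mul (A : Matrix (Fin D) (Fin D) ℂ)
    (h : EuclideanSpace ℂ (Fin D) → ℝ) (c : ℝ) :
    weightedMoment k A (fun φ => c * h φ) = c • weightedMoment k A h := by
  ext i j
  simp only [weightedMoment, Matrix.of_apply, Matrix.smul_apply, Complex.ofReal_mul, mul_assoc,
    integral_const_mul, Complex.real_smul]

lemma weightedMoment_isHermitian (A : Matrix (Fin D) (Fin D) ℂ)
    (h : EuclideanSpace ℂ (Fin D) → ℝ) : (weightedMoment k A h).IsHermitian := by
  ext i j
  simp only [Matrix.conjTranspose_apply, weightedMoment, Matrix.of_apply]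
  rw [← starRingEnd_apply, ← integral_conj]
  refine integral_congr_ae (ae_of_all _ fun φ => ?_)
  have hreal : star (h φ : ℂ) = h φ := Complex.conj_ofReal _
  simp only [starRingEnd_apply, star_mul', star_star, hreal]
  ring

lemma star_dotProduct_weightedMoment_mulVec {A : Matrix (Fin D) (Fin D) ℂ}
    {h : EuclideanSpace ℂ (Fin D) → ℝ} (hh : IsMomentWeight k A h) (v : (Fin k → Fin D) → ℂ) :
    star v ⬝ᵥ (weightedMoment k A h).mulVec v =
      ((∫ φ, h φ * ‖tensorPoly v (act A φ)‖ ^ 2 ∂haar D : ℝ) : ℂ) := by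
  rw [← integral_complex_ofReal]
  have e : ∀ φ, ((h φ * ‖tensorPoly v (act A φ)‖ ^ 2 : ℝ) : ℂ) = ∑ i, ∑ j, star (v i) * v j *
      ((h φ : ℂ) * (tensorVec k (act A φ) i * star (tensorVec k (act A φ) j))) := by
    intro φ
    rw [Complex.ofReal_mul, normSq_tensorPoly, Finset.mul_sum]
    refine Finset.sum_congr rfl fun i _ => ?_
    rw [Finset.mul_sum]
    exact Finset.sum_congr rfl fun j _ => by ring
  simp only [e]
  rw [integral_finsetSum _ fun i _ => integrable_finsetSum _ fun j _ => (hh i j).const_mul _,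
    dotProduct]
  refine Finset.sum_congr rfl fun i _ => ?_
  rw [integral_finsetSum _ fun j _ => (hh i j).const_mul _, Matrix.mulVec, dotProduct,
    Finset.mul_sum]
  refine Finset.sum_congr rfl fun j _ => ?_
  rw [integral_const_mul, weightedMoment, Matrix.of_apply, Pi.star_apply]
  ring

lemma weightedMoment_posSemidef {A : Matrix (Fin D) (Fin D) ℂ}
    {h : EuclideanSpace ℂ (Fin D) → ℝ} (hh : IsMomentWeight k A h)
    (hpos : ∀ v : (Fin k → Fin D) → ℂ, 0 ≤ ∫ φ, h φ * ‖tensorPoly v (act A φ)‖ ^ 2 ∂haar D) :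
    (weightedMoment k A h).PosSemidef := by
  refine Matrix.PosSemidef.of_dotProduct_mulVec_nonneg (weightedMoment_isHermitian A h) fun v => ?_
  rw [star_dotProduct_weightedMoment_mulVec hh]
  exact_mod_cast hpos v

lemma trace_weightedMoment {A : Matrix (Fin D) (Fin D) ℂ}
    {h : EuclideanSpace ℂ (Fin D) → ℝ} (hh : IsMomentWeight k A h) :
    (weightedMoment k A h).trace = ((∫ φ, h φ * (‖act A φ‖ ^ 2) ^ k ∂haar D : ℝ) : ℂ) := by
  rw [← integral_complex_ofReal]
  have e : ∀ φ, ((h φ * (‖act A φ‖ ^ 2) ^ k : ℝ) : ℂ) = ∑ i,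
      ((h φ : ℂ) * (tensorVec k (act A φ) i * star (tensorVec k (act A φ) i))) := by
    intro φ
    rw [← sum_normSq_tensorVec, Complex.ofReal_mul, Complex.ofReal_sum, Finset.mul_sum]
    refine Finset.sum_congr rfl fun i _ => ?_
    rw [← starRingEnd_apply, Complex.mul_conj']
    push_cast
    rfl
  simp only [e]
  rw [integral_finsetSum _ fun i _ => hh i i]
  rfl

lemma schattenNorm_neg {n : Type*} [Fintype n] [DecidableEq n] (p : ℕ) (A : Matrix n n ℂ) :
    schattenNorm p (-A) = schattenNorm p A := by
  rw [schattenNorm, CFC.abs_neg, schattenNorm]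

lemma exists_unitary_diagonalization {n : Type*} [Fintype n] [DecidableEq n] {A : Matrix n n ℂ}
    (hA : A.IsHermitian) :
    ∃ (U : Matrix.unitaryGroup n ℂ) (d : n → ℝ),
      A = U.1 * Matrix.diagonal (fun i => (d i : ℂ)) * U.1.conjTranspose ∧
      (CFC.abs A).trace = ∑ i, ((|d i| : ℝ) : ℂ) ∧ (A.PosSemidef → ∀ i, 0 ≤ d i) := by
  refine ⟨hA.eigenvectorUnitary, hA.eigenvalues, ?_, ?_, fun h => h.eigenvalues_nonneg⟩
  · have := hA.spectral_theorem
    rwa [Unitary.conjStarAlgAut_apply] at this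
  · rw [CFC.abs_eq_cfc_norm A hA.isSelfAdjoint, hA.cfc_eq, Matrix.IsHermitian.cfc,
      Unitary.conjStarAlgAut_apply, Matrix.trace_mul_cycle, Unitary.coe_star_mul_self, one_mul,
      Matrix.trace_diagonal]
    rfl

lemma conjTranspose_mul_unitary {n : Type*} [Fintype n] [DecidableEq n]
    (U : Matrix.unitaryGroup n ℂ) : U.1.conjTranspose * U.1 = 1 :=
  Unitary.coe_star_mul_self U

lemma unitary_mul_conjTranspose {n : Type*} [Fintype n] [DecidableEq n]
    (U : Matrix.unitaryGroup n ℂ) : U.1 * U.1.conjTranspose = 1 :=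
  Unitary.coe_mul_star_self U

lemma conjTranspose_mul_conj_mul {n : Type*} [Fintype n] [DecidableEq n]
    (U : Matrix.unitaryGroup n ℂ) (A : Matrix n n ℂ) :
    U.1.conjTranspose * (U.1 * A * U.1.conjTranspose) * U.1 = A :=
  calc _ = (U.1.conjTranspose * U.1) * A * (U.1.conjTranspose * U.1) := by simp only [mul_assoc]
    _ = _ := by rw [conjTranspose_mul_unitary, one_mul, mul_one]

/-- The trace norm of a Hermitian matrix `H` with `-Q ≤ H ≤ Q` is at most the trace of `Q`: compare
the diagonal entries of both in an eigenbasis of `H`. -/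
lemma schattenNorm_one_le_trace {n : Type*} [Fintype n] [DecidableEq n] {H Q : Matrix n n ℂ}
    (hH : H.IsHermitian) (h1 : (Q - H).PosSemidef) (h2 : (Q + H).PosSemidef) :
    schattenNorm 1 H ≤ Q.trace.re := by
  obtain ⟨U, d, hspec, habs, -⟩ := exists_unitary_diagonalization hH
  have hdiag : U.1.conjTranspose * H * U.1 = Matrix.diagonal (fun i => (d i : ℂ)) := by
    rw [hspec, conjTranspose_mul_conj_mul]
  have htr : (U.1.conjTranspose * Q * U.1).trace = Q.trace := by
    rw [Matrix.trace_mul_cycle, unitary_mul_conjTranspose, one_mul]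
  have hle : ∀ i, |d i| ≤ ((U.1.conjTranspose * Q * U.1) i i).re := by
    intro i
    have hi : (U.1.conjTranspose * H * U.1) i i = (d i : ℂ) := by
      rw [hdiag, Matrix.diagonal_apply_eq]
    have a := (Complex.nonneg_iff.1 ((h1.conjTranspose_mul_mul_same U.1).diag_nonneg (i := i))).1
    have b := (Complex.nonneg_iff.1 ((h2.conjTranspose_mul_mul_same U.1).diag_nonneg (i := i))).1
    rw [Matrix.mul_sub, Matrix.sub_mul, Matrix.sub_apply, hi, Complex.sub_re,
      Complex.ofReal_re] at a
    rw [Matrix.mul_add, Matrix.add_mul, Matrix.add_apply, hi, Complex.add_re,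
      Complex.ofReal_re] at b
    exact abs_le.2 ⟨by linarith, by linarith⟩
  rw [schattenNorm, pow_one, habs, ← htr, Matrix.trace, Complex.re_sum, Complex.re_sum]
  simp only [Complex.ofReal_re, Nat.cast_one, div_one, Real.rpow_one, Matrix.diag_apply]
  exact Finset.sum_le_sum fun i _ => hle i

/-- The spectral decomposition of a density matrix. -/
lemma IsDensityMatrix.exists_diagonalization {σ : Matrix (Fin D) (Fin D) ℂ}
    (hσ : IsDensityMatrix σ) :
    ∃ (U : Matrix.unitaryGroup (Fin D) ℂ) (lam : Fin D → ℝ), (∀ l, 0 ≤ lam l) ∧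
      ∑ l, lam l = 1 ∧ U.1.conjTranspose * σ * U.1 = Matrix.diagonal (fun l => (lam l : ℂ)) ∧
      0 ≤ schattenNorm 2 σ ∧ ∑ l, lam l ^ 2 = schattenNorm 2 σ ^ 2 := by
  have hH := hσ.1.isHermitian
  obtain ⟨U, lam, hspec, -, hpos⟩ := exists_unitary_diagonalization hH
  have htr : σ.trace = ((∑ l, lam l : ℝ) : ℂ) := by
    rw [hspec, Matrix.trace_mul_cycle, conjTranspose_mul_unitary, one_mul, Matrix.trace_diagonal]
    push_cast
    rfl
  have htr2 : (σ * σ).trace = ((∑ l, lam l ^ 2 : ℝ) : ℂ) := by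
    rw [hspec]
    calc _ = (U.1 * (Matrix.diagonal (fun i => (lam i : ℂ)) * (U.1.conjTranspose * U.1)
          * Matrix.diagonal (fun i => (lam i : ℂ))) * U.1.conjTranspose).trace := by
            simp only [mul_assoc]
      _ = _ := by
          rw [conjTranspose_mul_unitary, mul_one, Matrix.trace_mul_cycle,
            conjTranspose_mul_unitary, one_mul, Matrix.diagonal_mul_diagonal,
            Matrix.trace_diagonal]
          push_cast
          exact Finset.sum_congr rfl fun i _ => by ring
  have hs : schattenNorm 2 σ = Real.sqrt (∑ l, lam l ^ 2) := by
    rw [schattenNorm, CFC.abs_sq, Matrix.star_eq_conjTranspose, hH.eq, htr2, Complex.ofReal_re,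
      Real.sqrt_eq_rpow]
    norm_num
  refine ⟨U, lam, hpos hσ.1, ?_, by rw [hspec, conjTranspose_mul_conj_mul], ?_, ?_⟩
  · rw [hσ.2] at htr
    exact_mod_cast htr.symm
  · rw [hs]; positivity
  · rw [hs, Real.sq_sqrt (Finset.sum_nonneg fun _ _ => sq_nonneg _)]

end

/-! ### The moments of the Scrooge ensembles -/

section

variable {D k : ℕ}

lemma IsMomentWeight.abs {A : Matrix (Fin D) (Fin D) ℂ} {h : EuclideanSpace ℂ (Fin D) → ℝ}
    (hm : Measurable h) (hh : IsMomentWeight k A h) : IsMomentWeight k A (fun φ => |h φ|) := by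
  intro i j
  refine (hh i j).mono ?_ (ae_of_all _ fun φ => by simp)
  have h1 := ((continuous_tensorVec (D := D) i).comp (continuous_act A)).measurable
  have h2 := ((continuous_tensorVec (D := D) j).comp (continuous_act A)).star.measurable
  exact ((Complex.measurable_ofReal.comp hm.abs).mul (h1.mul h2)).aestronglyMeasurable

lemma isMomentWeight_of_bounded [NeZero D] {A : Matrix (Fin D) (Fin D) ℂ}
    {h : EuclideanSpace ℂ (Fin D) → ℝ} (hm : Measurable h) (C : ℝ)
    (hC : ∀ φ, ‖φ‖ = 1 → |h φ| * (‖act A φ‖ ^ 2) ^ k ≤ C) : IsMomentWeight k A h := by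
  intro i j
  refine (integrable_const C).mono' ?_ ?_
  · have h1 := ((continuous_tensorVec (D := D) i).comp (continuous_act A)).measurable
    have h2 := ((continuous_tensorVec (D := D) j).comp (continuous_act A)).star.measurable
    exact ((Complex.measurable_ofReal.comp hm).mul (h1.mul h2)).aestronglyMeasurable
  · filter_upwards [ae_haar_norm_eq_one] with φ hφ
    refine le_trans ?_ (hC φ hφ)
    rw [norm_mul, norm_mul, norm_star, Complex.norm_real, Real.norm_eq_abs, ← pow_mul, two_mul,
      pow_add]
    gcongr <;> exact norm_tensorVec_le _ _

lemma normSq_act_le {A : Matrix (Fin D) (Fin D) ℂ} {φ : EuclideanSpace ℂ (Fin D)}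
    (hφ : ‖φ‖ = 1) : ‖act A φ‖ ^ 2 ≤ ‖Matrix.toEuclideanCLM (n := Fin D) (𝕜 := ℂ) A‖ ^ 2 := by
  have := norm_act_le A φ
  rw [hφ, mul_one] at this
  gcongr

lemma measurable_normSq_act (A : Matrix (Fin D) (Fin D) ℂ) :
    Measurable fun φ => ‖act A φ‖ ^ 2 :=
  ((continuous_act A).norm.pow 2).measurable

lemma isMomentWeight_one [NeZero D] (A : Matrix (Fin D) (Fin D) ℂ) :
    IsMomentWeight k A fun _ => 1 :=
  isMomentWeight_of_bounded measurable_const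
    ((‖Matrix.toEuclideanCLM (n := Fin D) (𝕜 := ℂ) A‖ ^ 2) ^ k) fun φ hφ => by
      rw [abs_one, one_mul]
      exact pow_le_pow_left₀ (by positivity) (normSq_act_le hφ) k

lemma inv_pow_mul_pow_succ_le {x : ℝ} (hx : 0 ≤ x) (n : ℕ) : (x ^ n)⁻¹ * x ^ (n + 1) ≤ x := by
  rw [pow_succ, ← mul_assoc]
  exact mul_le_of_le_one_left hx (inv_mul_le_one_of_le₀ le_rfl (pow_nonneg hx n))

lemma abs_inv_pow_sub_one_mul_pow {x : ℝ} (hx : 0 ≤ x) (n : ℕ) :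
    |(x ^ n)⁻¹ + (-1) * 1| * x ^ (n + 1) = |x - x ^ (n + 1)| := by
  rcases hx.eq_or_lt with h0 | h0
  · simp [← h0]
  · have h1 : x - x ^ (n + 1) = ((x ^ n)⁻¹ + (-1) * 1) * x ^ (n + 1) := by
      have : x ^ n ≠ 0 := (pow_pos h0 n).ne'
      field_simp
      ring
    rw [h1, abs_mul, abs_of_pos (pow_pos h0 (n + 1))]

lemma isMomentWeight_inv_pow [NeZero D] (A : Matrix (Fin D) (Fin D) ℂ) (n : ℕ) :
    IsMomentWeight (n + 1) A fun φ => ((‖act A φ‖ ^ 2) ^ n)⁻¹ :=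
  isMomentWeight_of_bounded ((measurable_normSq_act A).pow_const n).inv
    (‖Matrix.toEuclideanCLM (n := Fin D) (𝕜 := ℂ) A‖ ^ 2) fun φ hφ => by
      rw [abs_of_nonneg (by positivity)]
      exact (inv_pow_mul_pow_succ_le (by positivity) n).trans (normSq_act_le hφ)

lemma moment_unnormScrooge (k : ℕ) (σ : Matrix (Fin D) (Fin D) ℂ) :
    moment k (unnormScrooge σ) =
      weightedMoment k (CFC.sqrt ((D : ℂ) • σ)) fun _ => 1 := by
  ext i j
  rw [moment, Matrix.of_apply, unnormScrooge, weightedMoment, Matrix.of_apply, integral_map]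
  · simp only [tensorPow_ketbra, Complex.ofReal_one, one_mul]
  · exact (continuous_act _).measurable.aemeasurable
  · simp only [tensorPow_ketbra]
    exact ((continuous_tensorVec i).mul (continuous_tensorVec j).star).aestronglyMeasurable

lemma weightedMoment_one_eq_conj [NeZero D] (k : ℕ) (A : Matrix (Fin D) (Fin D) ℂ) :
    weightedMoment k A (fun _ => 1) =
      tensorPow k A * moment k (haar D) * (tensorPow k A).conjTranspose := by
  have hi : ∀ i j : Fin k → Fin D,
      Integrable (fun φ => tensorVec k φ i * star (tensorVec k φ j)) (haar D) := by
    intro i j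
    have h : ∀ φ : EuclideanSpace ℂ (Fin D), act 1 φ = φ := fun φ => by simp [act]
    simpa [h] using isMomentWeight_one (k := k) (1 : Matrix (Fin D) (Fin D) ℂ) i j
  ext i j
  have e : ∀ φ : EuclideanSpace ℂ (Fin D), ((1 : ℝ) : ℂ) *
      (tensorVec k (act A φ) i * star (tensorVec k (act A φ) j)) =
      ∑ q, ∑ p, tensorPow k A i p * (tensorVec k φ p * star (tensorVec k φ q)) *
        star (tensorPow k A j q) := by
    intro φ
    rw [tensorVec_act, Matrix.mulVec, Matrix.mulVec, dotProduct, dotProduct, star_sum,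
      Complex.ofReal_one, one_mul, Finset.sum_mul_sum, Finset.sum_comm]
    refine Finset.sum_congr rfl fun q _ => Finset.sum_congr rfl fun p _ => ?_
    rw [star_mul']
    ring
  rw [weightedMoment, Matrix.of_apply]
  simp only [e]
  rw [integral_finsetSum _ fun q _ => integrable_finsetSum _ fun p _ =>
    ((hi p q).const_mul _).mul_const _, Matrix.mul_apply]
  refine Finset.sum_congr rfl fun q _ => ?_
  rw [integral_finsetSum _ fun p _ => ((hi p q).const_mul _).mul_const _, Matrix.mul_apply,
    Finset.sum_mul]
  refine Finset.sum_congr rfl fun p _ => ?_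
  simp only [integral_mul_const, integral_const_mul, moment, Matrix.of_apply, tensorPow_ketbra,
    Matrix.conjTranspose_apply]

lemma commute_tensorPow_unitary_moment_haar [NeZero D] (k : ℕ)
    (U : Matrix.unitaryGroup (Fin D) ℂ) :
    Commute (tensorPow k U.1) (moment k (haar D)) := by
  have h : tensorPow k U.1 * moment k (haar D) * (tensorPow k U.1).conjTranspose =
      moment k (haar D) := by
    rw [← weightedMoment_one_eq_conj]
    ext i j
    simp only [weightedMoment, moment, Matrix.of_apply, tensorPow_ketbra, Complex.ofReal_one,
      one_mul]
    exact integral_haar_act_unitary U fun φ : EuclideanSpace ℂ (Fin D) =>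
      tensorVec k φ i * star (tensorVec k φ j)
  have hU : (tensorPow k U.1).conjTranspose * tensorPow k U.1 = 1 := by
    rw [← tensorPow_conjTranspose, ← tensorPow_mul, conjTranspose_mul_unitary, tensorPow_one]
  calc tensorPow k U.1 * moment k (haar D)
      = tensorPow k U.1 * moment k (haar D) *
          ((tensorPow k U.1).conjTranspose * tensorPow k U.1) := by rw [hU, mul_one]
    _ = _ := by rw [← mul_assoc, h]

lemma commute_tensorPow_diagonal_moment_haar (k : ℕ) (d : Fin D → ℂ) :
    Commute (tensorPow k (Matrix.diagonal d)) (moment k (haar D)) := by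
  rw [tensorPow_diagonal]
  ext i j
  rw [Matrix.diagonal_mul, Matrix.mul_diagonal]
  by_cases h : occupation i = occupation j
  · rw [prod_apply_eq_prod_pow d i, prod_apply_eq_prod_pow d j, h, mul_comm]
  · have := integral_haar_tensorVec_of_occupation_ne (D := D) (h := fun _ => 1)
      (fun _ _ _ => rfl) h
    have h0 : moment k (haar D) i j = 0 := by
      simpa [moment, tensorPow_ketbra] using this
    rw [h0, mul_zero, zero_mul]

/-- The Haar moment commutes with the tensor powers of Hermitian matrices, by unitary invariance
and the orthogonality of monomials. -/
lemma commute_tensorPow_moment_haar [NeZero D] (k : ℕ) {A : Matrix (Fin D) (Fin D) ℂ}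
    (hA : A.IsHermitian) : Commute (tensorPow k A) (moment k (haar D)) := by
  obtain ⟨U, d, h, -⟩ := exists_unitary_diagonalization hA
  have h2 := commute_tensorPow_unitary_moment_haar k (star U)
  rw [h, tensorPow_mul, tensorPow_mul]
  exact ((commute_tensorPow_unitary_moment_haar k U).mul_left
    (commute_tensorPow_diagonal_moment_haar k _)).mul_left h2

lemma IsDensityMatrix.neZero {σ : Matrix (Fin D) (Fin D) ℂ} (hσ : IsDensityMatrix σ) :
    NeZero D := by
  refine ⟨fun h => ?_⟩
  subst h
  have := hσ.2
  simp [Matrix.trace] at this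

lemma IsDensityMatrix.natCast_smul_nonneg {σ : Matrix (Fin D) (Fin D) ℂ} (hσ : IsDensityMatrix σ) :
    0 ≤ (D : ℂ) • σ :=
  Matrix.nonneg_iff_posSemidef.2 (hσ.1.smul (Nat.cast_nonneg (α := ℂ) D))

lemma sqrt_isHermitian (B : Matrix (Fin D) (Fin D) ℂ) : (CFC.sqrt B).IsHermitian :=
  (Matrix.nonneg_iff_posSemidef.1 (CFC.sqrt_nonneg B)).isHermitian

/-- The unnormalized Scrooge moment is `(D σ)^{⊗k} ρ_Haar`. -/
lemma moment_unnormScrooge_eq_mul (k : ℕ) {σ : Matrix (Fin D) (Fin D) ℂ}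
    (hσ : IsDensityMatrix σ) : moment k (unnormScrooge σ) =
      tensorPow k ((D : ℂ) • σ) * moment k (haar D) := by
  have := hσ.neZero
  set A := CFC.sqrt ((D : ℂ) • σ) with hA
  have hAH : A.IsHermitian := sqrt_isHermitian _
  have hAA : A * A = (D : ℂ) • σ := CFC.sqrt_mul_sqrt_self _ hσ.natCast_smul_nonneg
  rw [moment_unnormScrooge, weightedMoment_one_eq_conj, ← tensorPow_conjTranspose, hAH.eq,
    mul_assoc, ← (commute_tensorPow_moment_haar k hAH).eq, ← mul_assoc, ← tensorPow_mul, hAA]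

lemma IsDensityMatrix.normSq_act_sqrt {σ : Matrix (Fin D) (Fin D) ℂ} (hσ : IsDensityMatrix σ)
    (φ : EuclideanSpace ℂ (Fin D)) :
    ‖act (CFC.sqrt ((D : ℂ) • σ)) φ‖ ^ 2 = D * expVal σ φ := by
  rw [normSq_act, (sqrt_isHermitian _).eq, CFC.sqrt_mul_sqrt_self _ hσ.natCast_smul_nonneg]
  exact_mod_cast expVal_smul (D : ℝ) σ φ

lemma IsDensityMatrix.sqrt_natCast_smul {σ : Matrix (Fin D) (Fin D) ℂ} (hσ : IsDensityMatrix σ) :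
    CFC.sqrt ((D : ℂ) • σ) = ((Real.sqrt D : ℝ) : ℂ) • CFC.sqrt σ := by
  refine CFC.sqrt_unique ?_ ?_
  · rw [smul_mul_smul_comm, CFC.sqrt_mul_sqrt_self σ (Matrix.nonneg_iff_posSemidef.2 hσ.1),
      ← Complex.ofReal_mul, Real.mul_self_sqrt (Nat.cast_nonneg D)]
    simp
  · refine Matrix.nonneg_iff_posSemidef.2
      ((Matrix.nonneg_iff_posSemidef.1 (CFC.sqrt_nonneg σ)).smul ?_)
    exact_mod_cast Real.sqrt_nonneg D

/-- The Scrooge moment of order `n + 1` is a moment of the unnormalized vectors `√(Dσ) φ`, weighted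
by `X ^ (-n)` with `X = ‖√(Dσ) φ‖ ^ 2 = D ⟨φ|σ|φ⟩`. -/
lemma moment_scrooge (n : ℕ) {σ : Matrix (Fin D) (Fin D) ℂ} (hσ : IsDensityMatrix σ) :
    moment (n + 1) (scrooge σ) = weightedMoment (n + 1) (CFC.sqrt ((D : ℂ) • σ))
      fun φ => ((‖act (CFC.sqrt ((D : ℂ) • σ)) φ‖ ^ 2) ^ n)⁻¹ := by
  have := hσ.neZero
  have hD := natCast_D_pos (D := D)
  ext i j
  have hmB : Measurable (act (CFC.sqrt σ)) := (continuous_act _).measurable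
  have hX : ∀ φ, (D : ℝ) * expVal σ φ = ‖act (CFC.sqrt ((D : ℂ) • σ)) φ‖ ^ 2 := fun φ =>
    (hσ.normSq_act_sqrt φ).symm
  rw [moment, Matrix.of_apply, scrooge, weightedMoment, Matrix.of_apply, integral_map]
  · simp only [hX]
    rw [integral_withDensity_eq_integral_toReal_smul]
    · refine integral_congr_ae (ae_of_all _ fun φ => ?_)
      beta_reduce
      set ψ := act (CFC.sqrt ((D : ℂ) • σ)) φ with hψ
      have hunit : (‖act (CFC.sqrt σ) φ‖⁻¹ : ℂ) • act (CFC.sqrt σ) φ = (‖ψ‖⁻¹ : ℂ) • ψ := by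
        have h1 : ψ = ((Real.sqrt D : ℝ) : ℂ) • act (CFC.sqrt σ) φ := by
          rw [hψ, hσ.sqrt_natCast_smul]
          simp [act, Matrix.smul_mulVec]
        have hne : ((Real.sqrt D : ℝ) : ℂ) ≠ 0 := by
          exact_mod_cast (Real.sqrt_pos.2 hD).ne'
        rw [h1, norm_smul, Complex.norm_real, Real.norm_of_nonneg (Real.sqrt_nonneg _), smul_smul]
        congr 1
        push_cast
        field_simp
      simp only [ENNReal.toReal_ofReal (sq_nonneg ‖ψ‖), tensorPow_ketbra, hunit, tensorVec_smul,
        Complex.real_smul]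
      rcases eq_or_ne ψ 0 with h0 | h0
      · simp [h0, tensorVec]
      · have hn : (‖ψ‖ : ℂ) ≠ 0 := by exact_mod_cast norm_ne_zero_iff.2 h0
        have hs : star ((‖ψ‖⁻¹ : ℂ) ^ (n + 1)) = (‖ψ‖⁻¹ : ℂ) ^ (n + 1) := by
          rw [← Complex.ofReal_inv, ← Complex.ofReal_pow]
          exact Complex.conj_ofReal _
        rw [star_mul', hs]
        push_cast
        simp only [inv_pow]
        field_simp
        ring
    · exact ((measurable_normSq_act _)).ennreal_ofReal
    · exact ae_of_all _ fun _ => ENNReal.ofReal_lt_top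
  · refine Measurable.aemeasurable ?_
    have h1 : Measurable fun φ => ((‖act (CFC.sqrt σ) φ‖ : ℝ) : ℂ)⁻¹ :=
      (Complex.measurable_ofReal.comp hmB.norm).inv
    exact h1.smul hmB
  · simp only [tensorPow_ketbra]
    exact ((continuous_tensorVec i).mul (continuous_tensorVec j).star).aestronglyMeasurable

/-- Positivity of a weighted moment can be tested on monomials in an eigenbasis. -/
lemma weightedMoment_posSemidef_of_monoSq {A : Matrix (Fin D) (Fin D) ℂ}
    {U : Matrix.unitaryGroup (Fin D) ℂ} {lam : Fin D → ℝ}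
    (hX : ∀ φ, ‖act A (act U.1 φ)‖ ^ 2 = D * quad lam φ) {g : ℝ → ℝ} (hg : Measurable g)
    (hw : IsMomentWeight k A fun φ => g (‖act A φ‖ ^ 2))
    (hint : ∀ α : Fin D → ℕ, ∑ l, α l = k →
      Integrable (fun φ => g (D * quad lam φ) * monoSq α φ) (haar D))
    (hpos : ∀ α : Fin D → ℕ, ∑ l, α l = k →
      0 ≤ ∫ φ, g (D * quad lam φ) * monoSq α φ ∂haar D) :
    (weightedMoment k A fun φ => g (‖act A φ‖ ^ 2)).PosSemidef := by
  refine weightedMoment_posSemidef hw fun v => ?_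
  rw [← integral_haar_act_unitary U]
  simp only [hX]
  simp only [act_act A, tensorPoly_act]
  refine integral_haar_normSq_tensorPoly_nonneg (h := fun φ => g (D * quad lam φ))
    (hg.comp ((measurable_quad lam).const_mul _)) (fun φ ψ h => ?_) hint hpos _
  simp only [quad, h]

/-- Two-sided comparison of `S` with `T` within a factor `1 ± η` gives all relative error bounds
with `ε ≥ 2 η`. -/
lemma relative_bounds {n : Type*} [Fintype n] {S T : Matrix n n ℂ} {η ε : ℝ} (hη0 : 0 ≤ η)
    (hη : η ≤ 1 / 2) (hε : 2 * η ≤ ε) (hS : S.PosSemidef) (hT : T.PosSemidef)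
    (h1 : (S - (1 - η) • T).PosSemidef) (h2 : ((1 + η) • T - S).PosSemidef) :
    ((1 - ε) • S ≤ T ∧ T ≤ (1 + ε) • S) ∧ (1 - ε) • T ≤ S ∧ S ≤ (1 + ε) • T := by
  simp only [Matrix.le_iff]
  refine ⟨⟨?_, ?_⟩, ?_, ?_⟩
  · have : T - (1 - ε) • S =
        (1 - η) • ((1 + η) • T - S) + (η ^ 2) • T + (ε - η) • S := by module
    rw [this]
    exact ((h2.smul (by linarith)).add (hT.smul (sq_nonneg η))).add (hS.smul (by linarith))
  · have : (1 + ε) • S - T = (1 + 2 * η) • (S - (1 - η) • T) + (η * (1 - 2 * η)) • T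
        + (ε - 2 * η) • S := by module
    rw [this]
    exact ((h1.smul (by linarith)).add (hT.smul (mul_nonneg hη0 (by linarith)))).add
      (hS.smul (by linarith))
  · have : S - (1 - ε) • T = (S - (1 - η) • T) + (ε - η) • T := by module
    rw [this]
    exact h1.add (hT.smul (by linarith))
  · have : (1 + ε) • T - S = ((1 + η) • T - S) + (ε - η) • T := by module
    rw [this]
    exact h2.add (hT.smul (by linarith))

lemma eigenvalue_bounds [NeZero D] {lam : Fin D → ℝ} {s : ℝ}
    (hl : ∀ l, 0 ≤ lam l) (hsum : ∑ l, lam l = 1) (hs0 : 0 ≤ s) (hs2 : ∑ l, lam l ^ 2 = s ^ 2) :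
    (∀ l, lam l ≤ s) ∧ 1 / (D : ℝ) ≤ s := by
  have hD := natCast_D_pos (D := D)
  have hle : ∀ l, lam l ≤ s := fun l => by
    rw [← pow_le_pow_iff_left₀ (hl l) hs0 two_ne_zero, ← hs2]
    exact Finset.single_le_sum (f := fun l => lam l ^ 2) (fun _ _ => sq_nonneg _)
      (Finset.mem_univ l)
  refine ⟨hle, ?_⟩
  rw [div_le_iff₀ hD, ← hsum]
  calc ∑ l, lam l ≤ ∑ _l : Fin D, s := Finset.sum_le_sum fun l _ => hle l
    _ = s * D := by simp [mul_comm]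

/-- The relative error estimate, with the error `6 k ^ 2 ‖σ‖_2` and `k = n + 1`. -/
lemma scrooge_relative_bounds {n : ℕ} {σ : Matrix (Fin D) (Fin D) ℂ} (hσ : IsDensityMatrix σ)
    (hn : ((n + 1 : ℕ) : ℝ) ^ 2 * schattenNorm 2 σ ≤ 1 / 12) :
    (moment (n + 1) (scrooge σ) - (1 - 6 * (((n + 1 : ℕ) : ℝ) ^ 2 * schattenNorm 2 σ)) •
      moment (n + 1) (unnormScrooge σ)).PosSemidef ∧
    ((1 + 6 * (((n + 1 : ℕ) : ℝ) ^ 2 * schattenNorm 2 σ)) • moment (n + 1) (unnormScrooge σ) -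
      moment (n + 1) (scrooge σ)).PosSemidef := by
  have := hσ.neZero
  have hD := natCast_D_pos (D := D)
  obtain ⟨U, lam, hl, hsum, hdiag, hs0, hs2⟩ := hσ.exists_diagonalization
  set s := schattenNorm 2 σ with hs
  obtain ⟨hle, hDs⟩ := eigenvalue_bounds hl hsum hs0 hs2
  set A := CFC.sqrt ((D : ℂ) • σ) with hA
  set η := 6 * (((n + 1 : ℕ) : ℝ) ^ 2 * s) with hη
  have hX : ∀ φ, ‖act A (act U.1 φ)‖ ^ 2 = D * quad lam φ := fun φ => by
    rw [hσ.normSq_act_sqrt, expVal_act, hdiag, expVal_diagonal]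
  have hns : n * s < 1 := by
    have h1 : (n : ℝ) ≤ ((n + 1 : ℕ) : ℝ) ^ 2 := by
      push_cast
      nlinarith [Nat.cast_nonneg (α := ℝ) n]
    nlinarith
  have hinti : ∀ α : Fin D → ℕ, ∑ l, α l = n + 1 →
      Integrable (fun φ => ((D * quad lam φ) ^ n)⁻¹ * monoSq α φ) (haar D) := fun α hα => by
    simpa only [mul_pow, mul_inv, mul_assoc] using
      (integral_haar_quad_inv_pow_le hl hsum hs0 hle hns hα).1.const_mul (((D : ℝ) ^ n)⁻¹)
  have hw1 := isMomentWeight_one (k := n + 1) A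
  have hwn := isMomentWeight_inv_pow A n
  rw [moment_scrooge n hσ, moment_unnormScrooge, ← hA]
  constructor
  · have he : ∀ (α : Fin D → ℕ) φ, ((D * quad lam φ) ^ n)⁻¹ * monoSq α φ - (1 - η) * monoSq α φ =
        (((D * quad lam φ) ^ n)⁻¹ + (-(1 - η)) * 1) * monoSq α φ := fun α φ => by ring
    have h := weightedMoment_posSemidef_of_monoSq (k := n + 1) hX
      (g := fun x => (x ^ n)⁻¹ + (-(1 - η)) * 1) (by fun_prop)
      (hwn.add (hw1.const_mul _))
      (fun α hα => by
        simp only [← he α]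
        exact (hinti α hα).sub ((integrable_haar_monoSq α).const_mul _))
      (fun α hα => by
        have hb := (integral_haar_weighted_bounds hl hsum hle hDs hn hα).1
        simp only [← he α]
        rw [integral_sub (hinti α hα) ((integrable_haar_monoSq α).const_mul _),
          integral_const_mul]
        linarith)
    rw [weightedMoment_add hwn (hw1.const_mul _), weightedMoment_const_mul, neg_smul,
      ← sub_eq_add_neg] at h
    exact h
  · have he : ∀ (α : Fin D → ℕ) φ, (1 + η) * monoSq α φ - ((D * quad lam φ) ^ n)⁻¹ * monoSq α φ =
        ((1 + η) * 1 + (-1) * ((D * quad lam φ) ^ n)⁻¹) * monoSq α φ := fun α φ => by ring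
    have h := weightedMoment_posSemidef_of_monoSq (k := n + 1) hX
      (g := fun x => (1 + η) * 1 + (-1) * (x ^ n)⁻¹) (by fun_prop)
      ((hw1.const_mul (1 + η)).add (hwn.const_mul (-1)))
      (fun α hα => by
        simp only [← he α]
        exact ((integrable_haar_monoSq α).const_mul _).sub (hinti α hα))
      (fun α hα => by
        have hb := (integral_haar_weighted_bounds hl hsum hle hDs hn hα).2
        simp only [← he α]
        rw [integral_sub ((integrable_haar_monoSq α).const_mul _) (hinti α hα),
          integral_const_mul]
        linarith)
    rw [weightedMoment_add (hw1.const_mul (1 + η)) (hwn.const_mul (-1)), weightedMoment_const_mul,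
      weightedMoment_const_mul, neg_one_smul, ← sub_eq_add_neg] at h
    exact h

/-- The trace norm estimate, by the triangle inequality under the integral: the rank-one operators
`(|ψ⟩⟨ψ|)^{⊗k}` with `ψ = √(Dσ) φ` have trace `X ^ k`, so the distance is at most
`E |X ^ (1 - k) - 1| X ^ k = E |X - X ^ k|`. -/
lemma schattenNorm_scrooge_sub_le {n : ℕ} {σ : Matrix (Fin D) (Fin D) ℂ} (hσ : IsDensityMatrix σ)
    (hn : ((n + 1 : ℕ) : ℝ) ^ 2 * schattenNorm 2 σ ≤ 1 / 12) :
    schattenNorm 1 (moment (n + 1) (scrooge σ) - moment (n + 1) (unnormScrooge σ)) ≤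
      2 * (n * schattenNorm 2 σ) := by
  have := hσ.neZero
  have hD := natCast_D_pos (D := D)
  obtain ⟨U, lam, hl, hsum, hdiag, hs0, hs2⟩ := hσ.exists_diagonalization
  set s := schattenNorm 2 σ with hs
  obtain ⟨hle, hDs⟩ := eigenvalue_bounds hl hsum hs0 hs2
  have hspos : 0 < s := lt_of_lt_of_le (by positivity) hDs
  set A := CFC.sqrt ((D : ℂ) • σ) with hA
  have hX : ∀ φ, ‖act A (act U.1 φ)‖ ^ 2 = D * quad lam φ := fun φ => by
    rw [hσ.normSq_act_sqrt, expVal_act, hdiag, expVal_diagonal]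
  have hw1 := isMomentWeight_one (k := n + 1) A
  have hwn := isMomentWeight_inv_pow A n
  set h : EuclideanSpace ℂ (Fin D) → ℝ := fun φ => ((‖act A φ‖ ^ 2) ^ n)⁻¹ + (-1) * 1 with hh
  have hwh : IsMomentWeight (n + 1) A h := hwn.add (hw1.const_mul _)
  have hhm : Measurable h := by
    have := measurable_normSq_act A
    simp only [hh]
    fun_prop
  have hwa : IsMomentWeight (n + 1) A fun φ => |h φ| := hwh.abs hhm
  have hdiff : moment (n + 1) (scrooge σ) - moment (n + 1) (unnormScrooge σ) =
      weightedMoment (n + 1) A h := by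
    rw [moment_scrooge n hσ, moment_unnormScrooge, weightedMoment_add hwn (hw1.const_mul _),
      weightedMoment_const_mul, neg_one_smul, ← sub_eq_add_neg]
  have hp1 : (weightedMoment (n + 1) A (fun φ => |h φ|) -
      weightedMoment (n + 1) A h).PosSemidef := by
    have e : weightedMoment (n + 1) A (fun φ => |h φ|) - weightedMoment (n + 1) A h =
        weightedMoment (n + 1) A (fun φ => |h φ| + (-1) * h φ) := by
      rw [weightedMoment_add hwa (hwh.const_mul _), weightedMoment_const_mul, neg_one_smul,
        ← sub_eq_add_neg]
    rw [e]
    refine weightedMoment_posSemidef (hwa.add (hwh.const_mul _)) fun v => integral_nonneg fun φ =>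
      mul_nonneg ?_ (by positivity)
    linarith [le_abs_self (h φ)]
  have hp2 : (weightedMoment (n + 1) A (fun φ => |h φ|) +
      weightedMoment (n + 1) A h).PosSemidef := by
    rw [← weightedMoment_add hwa hwh]
    refine weightedMoment_posSemidef (hwa.add hwh) fun v => integral_nonneg fun φ =>
      mul_nonneg ?_ (by positivity)
    linarith [neg_abs_le (h φ)]
  rw [hdiff]
  refine (schattenNorm_one_le_trace (weightedMoment_isHermitian A h) hp1 hp2).trans ?_
  rw [trace_weightedMoment hwa, Complex.ofReal_re]
  have hpt : ∀ φ, |h φ| * (‖act A φ‖ ^ 2) ^ (n + 1) =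
      |‖act A φ‖ ^ 2 - (‖act A φ‖ ^ 2) ^ (n + 1)| := fun φ => by
    have := abs_inv_pow_sub_one_mul_pow (x := ‖act A φ‖ ^ 2) (by positivity) n
    rw [← this]
  simp only [hpt]
  rw [← integral_haar_act_unitary U]
  simp only [hX]
  exact integral_haar_abs_sub_pow_le hl hsum hle hspos hs2 hn

end

end Scrooge

end

theorem lemma1 :
    (∀ (D k : ℕ) (σ : Matrix (Fin D) (Fin D) ℂ), Scrooge.IsDensityMatrix σ →
      Scrooge.moment k (Scrooge.unnormScrooge σ) =
        Scrooge.tensorPow k ((D : ℂ) • σ) * Scrooge.moment k (Scrooge.haar D)) ∧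
    ∃ c C : ℝ, 0 < c ∧ 0 < C ∧
      ∀ (D k : ℕ) (σ : Matrix (Fin D) (Fin D) ℂ), 1 ≤ k → Scrooge.IsDensityMatrix σ →
        (k : ℝ) ^ 2 * Scrooge.schattenNorm 2 σ ≤ c →
        Scrooge.IsAdditiveScroogeDesign σ k (Scrooge.unnormScrooge σ)
          (C * (k * Scrooge.schattenNorm 2 σ)) ∧
        Scrooge.schattenNorm 1
            (Scrooge.moment k (Scrooge.scrooge σ) - Scrooge.moment k (Scrooge.unnormScrooge σ)) ≤
          C * (k * Scrooge.schattenNorm 2 σ) ∧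
        Scrooge.IsRelativeScroogeDesign σ k (Scrooge.unnormScrooge σ)
          (C * (4 ^ k * k * Scrooge.schattenNorm 2 σ)) ∧
        (1 - C * (4 ^ k * k * Scrooge.schattenNorm 2 σ)) •
            Scrooge.moment k (Scrooge.unnormScrooge σ) ≤ Scrooge.moment k (Scrooge.scrooge σ) ∧
        Scrooge.moment k (Scrooge.scrooge σ) ≤
          (1 + C * (4 ^ k * k * Scrooge.schattenNorm 2 σ)) •
            Scrooge.moment k (Scrooge.unnormScrooge σ) := by
  refine ⟨fun D k σ hσ => Scrooge.moment_unnormScrooge_eq_mul k hσ, 1 / 12, 12, by norm_num,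
    by norm_num, fun D k σ hk hσ hc => ?_⟩
  obtain ⟨n, rfl⟩ : ∃ n, k = n + 1 := ⟨k - 1, by omega⟩
  have := hσ.neZero
  obtain ⟨-, -, -, -, -, hs0, -⟩ := hσ.exists_diagonalization
  set s := Scrooge.schattenNorm 2 σ with hs
  have htr := Scrooge.schattenNorm_scrooge_sub_le hσ hc
  rw [← hs] at htr
  have hns : (n : ℝ) * s ≤ ((n + 1 : ℕ) : ℝ) * s := by
    gcongr
    exact_mod_cast Nat.le_succ n
  have hns0 : 0 ≤ (n : ℝ) * s := by positivity
  have hSpos : (Scrooge.moment (n + 1) (Scrooge.scrooge σ)).PosSemidef := by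
    rw [Scrooge.moment_scrooge n hσ]
    exact Scrooge.weightedMoment_posSemidef (Scrooge.isMomentWeight_inv_pow _ n) fun v =>
      MeasureTheory.integral_nonneg fun φ => by positivity
  have hTpos : (Scrooge.moment (n + 1) (Scrooge.unnormScrooge σ)).PosSemidef := by
    rw [Scrooge.moment_unnormScrooge]
    exact Scrooge.weightedMoment_posSemidef (Scrooge.isMomentWeight_one _) fun v =>
      MeasureTheory.integral_nonneg fun φ => by positivity
  obtain ⟨h1, h2⟩ := Scrooge.scrooge_relative_bounds hσ hc
  have h4 : ((n + 1 : ℕ) : ℝ) ≤ 4 ^ (n + 1) := by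
    exact_mod_cast (Nat.lt_pow_self (by norm_num : 1 < 4)).le
  have hε : 2 * (6 * (((n + 1 : ℕ) : ℝ) ^ 2 * s)) ≤ 12 * (4 ^ (n + 1) * ((n + 1 : ℕ) : ℝ) * s) := by
    have : ((n + 1 : ℕ) : ℝ) ^ 2 * s ≤ 4 ^ (n + 1) * ((n + 1 : ℕ) : ℝ) * s := by
      rw [pow_two]
      gcongr
    linarith
  have hrel := Scrooge.relative_bounds (by positivity) (by linarith) hε hSpos hTpos h1 h2
  refine ⟨?_, by linarith, hrel⟩
  rw [Scrooge.IsAdditiveScroogeDesign, ← neg_sub, Scrooge.schattenNorm_neg]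
  linarith
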